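/- **Setting.** Let $\mathcal S\subseteq\mathbb R^n$ and $\mathcal A\subseteq\mathbb R^m$ be Borel convex sets with non-empty interior, and let $(\mathcal S,\mathcal A,P,R,\mu,\gamma)$ be a discounted Markov decision process: $P$ a Markov kernel from $\mathcal S\times\mathcal A$ to $\mathcal S$, $R:\mathcal S\times\mathcal A\to[0,R_{\max}]$ measurable, $\mu$ a probability measure on $\mathcal S$, $\gamma\in[0,1)$. A policy is a Markov kernel $\pi(\cdot|s)$ from $\mathcal S$ to $\mathcal A$; fix a set $\Pi$ of admissible policies. Put $\mathbb P(\nu,\pi)=\mathbb E_{s\sim\nu,\,a\sim\pi(\cdot|s)}P(s,a)$, $\mathbb P^0(\nu,\pi)=\nu$, $\mathbb P^{t+1}(\nu,\pi)=\mathbb P(\mathbb P^t(\nu,\pi),\pi)$, $\rho^\pi_\mu=(1-\gamma)\sum_{t\ge0}\gamma^t\,\mathbb P^t(\mu,\pi)$, $V^\pi(s)=\mathbb E[\sum_{t\ge 0}\gamma^tR(s_t,a_t)\mid s_0=s;\pi]$, $Q^\pi(s,a)=R(s,a)+\gamma\,\mathbb E_{s'\sim P(s,a)}V^\pi(s')$,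 $A^\pi(s,\pi')=\mathbb E_{a\sim\pi'(\cdot|s)}[Q^\pi(s,a)-V^\pi(s)]$ and $\eta_\pi=\mathbb E_{s\sim\mu}V^\pi(s)$. Let $W(\zeta,\nu)=\inf_c\int\|x-y\|_2\,dc(x,y)\in[0,\infty]$ over couplings $c$ of $\zeta,\nu$, let $W(\pi_1,\pi_2)=\sup_sW(\pi_1(\cdot|s),\pi_2(\cdot|s))$, and let $\mathrm{Lip}(f;a)=\sup_a\|\nabla_af\|_2$. **Assumptions.** (i) For all $\pi,\pi'\in\Pi$ the functions $Q^\pi(s,a)$ (in $s$ and in $a$), $\nabla_sQ^\pi(s,a)$ (in $a$) and $A^\pi(s,\pi')$ (in $s$) are differentiable, and $\ell_\pi:=\sup_s\mathrm{Lip}(Q^\pi(s,a);a)$ and $\ell'_\pi:=\sup_s\|\mathrm{Lip}(\nabla_sQ^\pi(s,a);a)\|_2$ are finite, where in $\ell'_\pi$ the constant $\mathrm{Lip}$ is taken in each component of $\nabla_sQ^\pi$. (ii) There are $L_\pi,L_\mu\in[0,\infty)$ such that $W(\mathbb P(\nu,\pi_1),\mathbb P(\nu,\pi_2))\le L_\pi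 W(\pi_1,\pi_2)$ and $W(\mathbb P(\nu_1,\pi),\mathbb P(\nu_2,\pi))\le L_\mu W(\nu_1,\nu_2)$ for all probability measures $\nu,\nu_1,\nu_2$ on $\mathcal S$ and all $\pi,\pi_1,\pi_2\in\Pi$. (iii) Either $\gamma L_\mu<1$, and then $\kappa:=L_\pi/(1-\gamma L_\mu)$; or $W(\pi_1,\pi_2)<\infty$ for all $\pi_1,\pi_2\in\Pi$ and $$C_L:=\sup_{\nu,\ \pi_1,\pi_2\in\Pi,\ t}\ \sum_{k=1}^t\hat L^{(t-k)}_{\nu,\pi_1,\pi_2}\prod_{i=1}^{k-1}\tilde L^{(t-i)}_{\nu,\pi_1,\pi_2}<\infty,$$ and then $\kappa:=C_L$. Here $\hat L^{(t)}_{\nu,\pi_1,\pi_2}$ is the infimum of the $L\ge0$ with $W(\mathbb P(\nu_t,\pi_1),\mathbb P(\nu_t,\pi_2))=L\,W(\pi_1,\pi_2)$, and $\tilde L^{(t)}_{\nu,\pi_1,\pi_2}$ is the infimum of the $L\ge0$ with $W(\mathbb P(\nu_t,\pi_2),\mathbb P(\nu_t',\pi_2))=L\,W(\nu_t,\nu_t')$,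 where $\nu_t=\mathbb P^t(\nu,\pi_1)$ and $\nu_t'=\mathbb P^t(\nu,\pi_2)$. **Surrogate.** For $s\in\mathcal S$ and $1\le j\le n$ let $$\partial_j(\pi_1,\pi_2;s)=\limsup_{h\to0}\frac1{|h|}\,W\Big(\tfrac{\pi_2(\cdot|s+he_j)+\pi_1(\cdot|s)}2,\tfrac{\pi_2(\cdot|s)+\pi_1(\cdot|s+he_j)}2\Big)$$ (over $h\ne0$ with $s+he_j\in\mathcal S$), and $\mathcal L_{G^2}(\pi_1,\pi_2;s)=\sum_{j=1}^n\partial_j(\pi_1,\pi_2;s)^2$. This is the squared norm of the gradient at $s'=s$ of the non-negative function $s'\mapsto W\big(\tfrac{\pi_2(\cdot|s')+\pi_1(\cdot|s)}2,\tfrac{\pi_2(\cdot|s)+\pi_1(\cdot|s')}2\big)$, which vanishes at $s'=s$, formed with difference quotients by $|h|$. For $\alpha\neq0$ put $C_1'=\frac{2\gamma\kappa\,\ell_{\pi_1}}{1-\gamma}$, $C_2'=\frac{\gamma\kappa\,\ell'_{\pi_1}}{1-\gamma}$, $C_1=\frac{\alpha^2}2C_1'$, $C_2=C_2'+\frac{C_1'}{2\alpha^2}$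 and $$\mathcal L^{\sup}_{\pi_1}(\pi_2)=\eta_{\pi_1}+\frac1{1-\gamma}\mathbb E_{s\sim\rho^{\pi_1}_\mu}[A^{\pi_1}(s,\pi_2)]-C_1\sup_s\mathcal L_{G^2}(\pi_1,\pi_2;s)-C_2\sup_sW(\pi_2(\cdot|s),\pi_1(\cdot|s))^2\in[-\infty,\infty),$$ with $0\cdot\infty=0$. **Theorem.** For every $\alpha\ne0$ and all $\pi_1,\pi_2\in\Pi$: $\eta_{\pi_2}\ge\mathcal L^{\sup}_{\pi_1}(\pi_2)$ and $\mathcal L^{\sup}_{\pi_1}(\pi_1)=\eta_{\pi_1}$. Consequently, if $\pi_0,\pi_1,\pi_2,\dots\in\Pi$ are such that $\pi_{k+1}$ maximizes $\mathcal L^{\sup}_{\pi_k}$ over $\Pi$ for every $k$ (where the non-zero parameter $\alpha=\alpha_k$ may depend on $k$), then $\eta_{\pi_0}\le\eta_{\pi_1}\le\eta_{\pi_2}\le\cdots$. -/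

import Mathlib

open MeasureTheory ProbabilityTheory Filter Topology
open scoped ENNReal NNReal

noncomputable section

namespace TDPO

/-! ### Euclidean domains, gradients and Lipschitz constants -/

/-- The Euclidean space `ℝ^d` with its `2`-norm. -/
abbrev E (d : ℕ) := EuclideanSpace ℝ (Fin d)

/-- Gradient at `x` of a function defined on `X ⊆ ℝ^d` (the derivative is taken within `X`, so
the values of the extension outside `X` are irrelevant). -/
def gradOn {d : ℕ} {X : Set (E d)} (f : X → ℝ) (x : X) : E d :=
  gradientWithin (Function.extend Subtype.val f 0) X (x : E d)

/-- Differentiability on `X` of a function defined on `X ⊆ ℝ^d`. -/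
def DiffOn {d : ℕ} {X : Set (E d)} (f : X → ℝ) : Prop :=
  DifferentiableOn ℝ (Function.extend Subtype.val f 0) X

/-- `Lip(f; x) = sup_x ‖∇ f(x)‖₂`, as an element of `[0, ∞]`. -/
def lipConst {d : ℕ} {X : Set (E d)} (f : X → ℝ) : ℝ≥0∞ := ⨆ x : X, ‖gradOn f x‖ₑ

/-! ### The Wasserstein distance -/

/-- `c` is a coupling of `ζ` and `ν`. -/
def IsCoupling {X : Type*} [MeasurableSpace X] (ζ ν : Measure X) (c : Measure (X × X)) : Prop :=
  c.map Prod.fst = ζ ∧ c.map Prod.snd = ν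

/-- The Wasserstein distance `W(ζ, ν) = inf_c ∫ ‖x - y‖ dc(x, y)`, with values in `[0, ∞]`. -/
def wass {X : Type*} [MeasurableSpace X] [PseudoEMetricSpace X] (ζ ν : Measure X) : ℝ≥0∞ :=
  ⨅ (c : Measure (X × X)) (_ : IsCoupling ζ ν c), ∫⁻ p, edist p.1 p.2 ∂c

/-! ### Markov decision processes and policies -/

/-- An infinite-horizon discounted MDP with state space `S ⊆ ℝ^n` and action space `A ⊆ ℝ^m`. -/
structure MDP {n m : ℕ} (S : Set (E n)) (A : Set (E m)) where
  /-- transition dynamics -/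
  P : Kernel (S × A) S
  markov : IsMarkovKernel P
  /-- reward -/
  R : S × A → ℝ
  measurable_R : Measurable R
  Rmax : ℝ
  R_mem : ∀ x, R x ∈ Set.Icc 0 Rmax
  /-- initial state distribution -/
  μ : Measure S
  prob : IsProbabilityMeasure μ
  /-- discount factor -/
  γ : ℝ
  γ_nonneg : 0 ≤ γ
  γ_lt_one : γ < 1

/-- A policy `s ↦ π(· | s)`: a Markov kernel from states to actions. -/
structure Policy {n m : ℕ} (S : Set (E n)) (A : Set (E m)) where
  toKernel : Kernel S A
  markov : IsMarkovKernel toKernel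

attribute [instance] MDP.markov MDP.prob Policy.markov

/-- `W(π₁, π₂) = sup_s W(π₁(·|s), π₂(·|s))`. -/
def policyW {n m : ℕ} {S : Set (E n)} {A : Set (E m)} (π₁ π₂ : Policy S A) : ℝ≥0∞ :=
  ⨆ s : S, wass (π₁.toKernel s) (π₂.toKernel s)

/-- The mixture `(ζ + ν) / 2`. -/
def mix {X : Type*} [MeasurableSpace X] (ζ ν : Measure X) : Measure X := (2⁻¹ : ℝ≥0∞) • (ζ + ν)

/-- `W((π₂(·|s') + π₁(·|s)) / 2, (π₂(·|s) + π₁(·|s')) / 2)`. It is nonnegative and vanishes at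
`s' = s`. -/
def mixW {n m : ℕ} {S : Set (E n)} {A : Set (E m)} (π₁ π₂ : Policy S A) (s s' : S) : ℝ≥0∞ :=
  wass (mix (π₂.toKernel s') (π₁.toKernel s)) (mix (π₂.toKernel s) (π₁.toKernel s'))

/-- The `j`-th partial derivative of `s' ↦ mixW π₁ π₂ s s'` at `s' = s`. The function is
nonnegative and vanishes at `s`, so it has a (typically non-smooth) minimum there, and the
derivative is the limit of `mixW π₁ π₂ s (s + h e_j) / |h|` as `h → 0`, `h ≠ 0`, `s + h e_j ∈ S`
(for differentiable deterministic policies: half the norm of the difference of the `j`-th columns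
of the two Jacobians). It is written with `limsup` so as to be defined in all cases. -/
def partialMixW {n m : ℕ} {S : Set (E n)} {A : Set (E m)} (π₁ π₂ : Policy S A) (s : S)
    (j : Fin n) : ℝ≥0∞ :=
  limsup (fun s' : S => mixW π₁ π₂ s s' / edist s' s)
    (𝓝[{s' : S | s' ≠ s ∧ ∃ h : ℝ, (s' : E n) = (s : E n) + h • EuclideanSpace.single j 1}] s)

/-- The sensitivity term `L_{G²}(π₁, π₂; s) = ‖∇_{s'} mixW(s, s')|_{s'=s}‖₂²`. -/
def LG2 {n m : ℕ} {S : Set (E n)} {A : Set (E m)} (π₁ π₂ : Policy S A) (s : S) : ℝ≥0∞ :=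
  ∑ j : Fin n, partialMixW π₁ π₂ s j ^ 2

namespace MDP

variable {n m : ℕ} {S : Set (E n)} {A : Set (E m)} (M : MDP S A)

/-- `ℙ(ν, π) = E_{s∼ν, a∼π(s)} P(s, a)`. -/
def step (ν : Measure S) (π : Policy S A) : Measure S :=
  ν.bind (M.P ∘ₖ (Kernel.id ×ₖ π.toKernel))

/-- The `t`-step dynamics `ℙ^t(ν, π)`. -/
def steps (ν : Measure S) (π : Policy S A) : ℕ → Measure S
  | 0 => ν
  | t + 1 => M.step (steps ν π t) π

/-- The discounted visitation frequency `ρ_ν^π = (1 - γ) ∑_t γ^t ℙ^t(ν, π)`. -/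
def visit (ν : Measure S) (π : Policy S A) : Measure S :=
  Measure.sum fun t : ℕ => ENNReal.ofReal ((1 - M.γ) * M.γ ^ t) • M.steps ν π t

/-- The value function: expected discounted sum of the rewards started from `s`, where the state
at time `t` has law `ℙ^t(δ_s, π)`. -/
def V (π : Policy S A) (s : S) : ℝ :=
  ∑' t : ℕ, M.γ ^ t * ∫ s', ∫ a, M.R (s', a) ∂(π.toKernel s') ∂(M.steps (Measure.dirac s) π t)

/-- `Q^π(s, a) = R(s, a) + γ E_{s'∼P(s,a)} V^π(s')`. -/
def Q (π : Policy S A) (s : S) (a : A) : ℝ := M.R (s, a) + M.γ * ∫ s', M.V π s' ∂(M.P (s, a))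

/-- The advantage `A^π(s, π') = E_{a∼π'(s)} [Q^π(s, a) - V^π(s)]`. -/
def adv (π : Policy S A) (s : S) (π' : Policy S A) : ℝ :=
  ∫ a, (M.Q π s a - M.V π s) ∂(π'.toKernel s)

/-- The payoff `η_π = E_{s∼μ} V^π(s)`. -/
def payoff (π : Policy S A) : ℝ := ∫ s, M.V π s ∂M.μ

/-- `sup_s Lip(Q^π(s, a); a)`. -/
def lipQ (π : Policy S A) : ℝ≥0∞ := ⨆ s : S, lipConst fun a : A => M.Q π s a

/-- `sup_s ‖Lip(∇_s Q^π(s, a); a)‖₂`, where `Lip` is taken in each of the `n` components. -/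
def lipGradQ (π : Policy S A) : ℝ≥0∞ :=
  ⨆ s : S, (∑ j : Fin n,
    lipConst (fun a : A => gradOn (fun s' : S => M.Q π s' a) s j) ^ 2) ^ (1 / 2 : ℝ)

/-- Regularity of the action values and advantages on the admissible class `Pol`: all the gradients
that are used exist, and the Lipschitz constants of `Q` and `∇_s Q` in the action are finite. -/
structure Regular (Pol : Set (Policy S A)) : Prop where
  diff_action : ∀ π ∈ Pol, ∀ s, DiffOn fun a : A => M.Q π s a
  diff_state : ∀ π ∈ Pol, ∀ a, DiffOn fun s : S => M.Q π s a
  diff_mixed : ∀ π ∈ Pol, ∀ s, ∀ j : Fin n,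
    DiffOn fun a : A => gradOn (fun s' : S => M.Q π s' a) s j
  diff_adv : ∀ π ∈ Pol, ∀ π' ∈ Pol, DiffOn fun s : S => M.adv π s π'
  lipQ_ne_top : ∀ π ∈ Pol, M.lipQ π ≠ ∞
  lipGradQ_ne_top : ∀ π ∈ Pol, M.lipGradQ π ≠ ∞

/-- The dynamics is Lipschitz with respect to the policy, with constant `Lπ`. -/
def LipschitzPolicy (Pol : Set (Policy S A)) (Lπ : ℝ≥0) : Prop :=
  ∀ ν : Measure S, IsProbabilityMeasure ν → ∀ π₁ ∈ Pol, ∀ π₂ ∈ Pol,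
    wass (M.step ν π₁) (M.step ν π₂) ≤ Lπ * policyW π₁ π₂

/-- The dynamics is Lipschitz with respect to the state distribution, with constant `Lμ`. -/
def LipschitzState (Pol : Set (Policy S A)) (Lμ : ℝ≥0) : Prop :=
  ∀ ν₁ ν₂ : Measure S, IsProbabilityMeasure ν₁ → IsProbabilityMeasure ν₂ → ∀ π ∈ Pol,
    wass (M.step ν₁ π) (M.step ν₂ π) ≤ Lμ * wass ν₁ ν₂

/-! ### Dynamics stability -/

/-- The least `L ≥ 0` with `W(ℙ(ν₁, π), ℙ(ν₂, π)) = L W(ν₁, ν₂)`. -/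
def ratioState (ν₁ ν₂ : Measure S) (π : Policy S A) : ℝ≥0∞ :=
  sInf {L | wass (M.step ν₁ π) (M.step ν₂ π) = L * wass ν₁ ν₂}

/-- The least `L ≥ 0` with `W(ℙ(ν, π₁), ℙ(ν, π₂)) = L W(π₁, π₂)`. -/
def ratioPolicy (ν : Measure S) (π₁ π₂ : Policy S A) : ℝ≥0∞ :=
  sInf {L | wass (M.step ν π₁) (M.step ν π₂) = L * policyW π₁ π₂}

/-- `L̃^{(t)}`. -/
def tildeL (ν : Measure S) (π₁ π₂ : Policy S A) (t : ℕ) : ℝ≥0∞ :=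
  M.ratioState (M.steps ν π₁ t) (M.steps ν π₂ t) π₂

/-- `L̂^{(t)}`. -/
def hatL (ν : Measure S) (π₁ π₂ : Policy S A) (t : ℕ) : ℝ≥0∞ :=
  M.ratioPolicy (M.steps ν π₁ t) π₁ π₂

/-- `C_L^{(t)} = ∑_{k=1}^t L̂^{(t-k)} ∏_{i=1}^{k-1} L̃^{(t-i)}`. -/
def CLt (ν : Measure S) (π₁ π₂ : Policy S A) (t : ℕ) : ℝ≥0∞ :=
  ∑ k ∈ Finset.Icc 1 t, M.hatL ν π₁ π₂ (t - k) *
    ∏ i ∈ Finset.Icc 1 (k - 1), M.tildeL ν π₁ π₂ (t - i)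

/-- `C_L`, the supremum of `C_L^{(t)}` over initial distributions, pairs of admissible policies
and times. -/
def CL (Pol : Set (Policy S A)) : ℝ≥0∞ :=
  ⨆ (ν : Measure S) (_ : IsProbabilityMeasure ν) (π₁ ∈ Pol) (π₂ ∈ Pol) (t : ℕ), M.CLt ν π₁ π₂ t

/-- `κ` is an admissible amplification constant of the dynamics: either `γ Lμ < 1` and
`κ = Lπ / (1 - γ Lμ)`, or the dynamics is stable (`C_L < ∞`, the distances of admissible policies
being finite) and `κ = C_L`, which is `Lπ / (1 - γ L̄μ)` for the `L̄μ` defined by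
`C_L = Lπ ∑_t (γ L̄μ)^t`. -/
def IsAmplification (Pol : Set (Policy S A)) (Lπ Lμ : ℝ≥0) (κ : ℝ≥0∞) : Prop :=
  (M.γ * Lμ < 1 ∧ κ = ENNReal.ofReal (Lπ / (1 - M.γ * Lμ))) ∨
  ((∀ π₁ ∈ Pol, ∀ π₂ ∈ Pol, policyW π₁ π₂ ≠ ∞) ∧ M.CL Pol ≠ ∞ ∧ κ = M.CL Pol)

/-! ### The surrogate -/

/-- `C₁' = sup_s 2 Lip(Q^{π₁}(s, a); a) γ κ / (1 - γ)`. -/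
def C1' (κ : ℝ≥0∞) (π₁ : Policy S A) : ℝ≥0∞ :=
  2 * M.lipQ π₁ * ENNReal.ofReal (M.γ / (1 - M.γ)) * κ

/-- `C₂' = sup_s ‖Lip(∇_s Q^{π₁}(s, a); a)‖₂ γ κ / (1 - γ)`. -/
def C2' (κ : ℝ≥0∞) (π₁ : Policy S A) : ℝ≥0∞ :=
  M.lipGradQ π₁ * ENNReal.ofReal (M.γ / (1 - M.γ)) * κ

/-- `C₁ = C₁' α² / 2`. -/
def C1 (κ : ℝ≥0∞) (α : ℝ) (π₁ : Policy S A) : ℝ≥0∞ :=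
  M.C1' κ π₁ * ENNReal.ofReal (α ^ 2 / 2)

/-- `C₂ = C₂' + C₁' / (2 α²)`. -/
def C2 (κ : ℝ≥0∞) (α : ℝ) (π₁ : Policy S A) : ℝ≥0∞ :=
  M.C2' κ π₁ + M.C1' κ π₁ * ENNReal.ofReal (1 / (2 * α ^ 2))

/-- The surrogate
`L^sup_{π₁}(π₂) = η_{π₁} + (1-γ)⁻¹ E_{s∼ρ_μ^{π₁}} A^{π₁}(s, π₂)
  - C₁ sup_s L_{G²}(π₁, π₂; s) - C₂ sup_s W(π₂(·|s), π₁(·|s))²`;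
it is `-∞` where the penalty is infinite. -/
def surrogate (κ : ℝ≥0∞) (α : ℝ) (π₁ π₂ : Policy S A) : EReal :=
  ((M.payoff π₁ + (1 - M.γ)⁻¹ * ∫ s, M.adv π₁ s π₂ ∂(M.visit M.μ π₁) : ℝ) : EReal) -
    ((M.C1 κ α π₁ * (⨆ s : S, LG2 π₁ π₂ s) +
      M.C2 κ α π₁ * (⨆ s : S, wass (π₂.toKernel s) (π₁.toKernel s) ^ 2) : ℝ≥0∞) : EReal)

end MDP

end TDPO

end

namespace TDPO

/-! ### Basic properties of the Wasserstein distance -/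

section Wasserstein

variable {X : Type*} [MeasurableSpace X]

/-! The surrogate minorizes $\eta$ and touches it at $\pi_1$, so monotone improvement is the usual
minorize-maximize argument; all the work lies in the lower bound.

By the performance difference formula (`payoff_sub_payoff`),
$\eta_{\pi_2}-\eta_{\pi_1}=\sum_t\gamma^t\,\mathbb E[A^{\pi_1}(s,\pi_2)]$ with $s\sim\mathbb
P^t(\mu,\pi_2)$. The linear part of the surrogate is the same series with $s\sim\mathbb
P^t(\mu,\pi_1)$. If $s\mapsto A^{\pi_1}(s,\pi_2)$ is $K$-Lipschitz, the easy half of Kantorovich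
duality (`enorm_integral_sub_le_wass`) bounds the difference by $K\sum_t\gamma^t W(\mathbb
P^t(\mu,\pi_1),\mathbb P^t(\mu,\pi_2))$.

The sum of distances is at most $\frac{\gamma\kappa}{1-\gamma}W(\pi_1,\pi_2)$
(`tsum_discount_wass_le`): the triangle inequality splits each step into a change of policy and a
change of state distribution, and the resulting linear recursion is summed.

For $K$, an increment of the advantage from $s$ to $s'$ splits into $Q(s',\cdot)$ integrated against
$\pi_2(s')+\pi_1(s)-\pi_2(s)-\pi_1(s')$, plus $Q(s',\cdot)-Q(s,\cdot)$ integrated against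
$\pi_2(s)-\pi_1(s)$. The first piece is controlled by the Wasserstein distance of the two mixtures,
the second by the Lipschitz constant in $a$ of $\nabla_sQ$. Hence $K=2\ell\sqrt{\sup_s\mathcal
L_{G^2}}+\ell' W(\pi_1,\pi_2)$ (`Regular.enorm_adv_sub_le`), and Young's inequality with weight
$\alpha$ separates the product $\sqrt{\sup_s\mathcal L_{G^2}}\,W$ into the two penalties. -/

theorem IsCoupling.isProbabilityMeasure {ζ ν : Measure X} [IsProbabilityMeasure ζ]
    {c : Measure (X × X)} (hc : IsCoupling ζ ν c) : IsProbabilityMeasure c := by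
  refine ⟨?_⟩
  have h := congrArg (fun m : Measure X => m Set.univ) hc.1
  simpa [Measure.map_apply measurable_fst] using h

theorem isCoupling_prod (ζ ν : Measure X) [IsProbabilityMeasure ζ] [IsProbabilityMeasure ν] :
    IsCoupling ζ ν (ζ.prod ν) := by
  constructor
  · simp [Measure.map_fst_prod]
  · simp [Measure.map_snd_prod]

theorem IsCoupling.swap {ζ ν : Measure X} {c : Measure (X × X)} (hc : IsCoupling ζ ν c) :
    IsCoupling ν ζ (c.map Prod.swap) := by
  constructor
  · rw [Measure.map_map measurable_fst measurable_swap]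
    exact hc.2
  · rw [Measure.map_map measurable_snd measurable_swap]
    exact hc.1

theorem IsCoupling.integral_sub {ζ ν : Measure X} {c : Measure (X × X)} (hc : IsCoupling ζ ν c)
    {f : X → ℝ} (hf : Measurable f) (hζ : Integrable f ζ) (hν : Integrable f ν) :
    ∫ x, f x ∂ζ - ∫ x, f x ∂ν = ∫ p, (f p.1 - f p.2) ∂c := by
  have h1 : Integrable (fun p : X × X => f p.1) c := by
    rw [← hc.1] at hζ
    exact hζ.comp_measurable measurable_fst
  have h2 : Integrable (fun p : X × X => f p.2) c := by
    rw [← hc.2] at hν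
    exact hν.comp_measurable measurable_snd
  rw [MeasureTheory.integral_sub h1 h2]
  congr 1
  · rw [← hc.1, integral_map (by fun_prop) hf.aestronglyMeasurable]
  · rw [← hc.2, integral_map (by fun_prop) hf.aestronglyMeasurable]

variable [PseudoEMetricSpace X]

theorem wass_le_of_isCoupling {ζ ν : Measure X} {c : Measure (X × X)} (hc : IsCoupling ζ ν c) :
    wass ζ ν ≤ ∫⁻ p, edist p.1 p.2 ∂c :=
  iInf₂_le c hc

variable [OpensMeasurableSpace X] [SecondCountableTopology X]

theorem wass_comm (ζ ν : Measure X) : wass ζ ν = wass ν ζ := by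
  have key : ∀ ζ ν : Measure X, wass ζ ν ≤ wass ν ζ := by
    intro ζ ν
    refine le_iInf₂ fun c hc => (wass_le_of_isCoupling hc.swap).trans ?_
    rw [lintegral_map (by fun_prop) measurable_swap]
    simp [edist_comm]
  exact le_antisymm (key _ _) (key _ _)

@[simp] theorem wass_self (ζ : Measure X) : wass ζ ζ = 0 := by
  have hd : Measurable fun x : X => (x, x) := by fun_prop
  have hc : IsCoupling ζ ζ (ζ.map fun x => (x, x)) := by
    constructor
    · rw [Measure.map_map measurable_fst hd]
      exact Measure.map_id
    · rw [Measure.map_map measurable_snd hd]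
      exact Measure.map_id
  refine le_antisymm ((wass_le_of_isCoupling hc).trans ?_) zero_le
  rw [lintegral_map (by fun_prop) hd]
  simp

/-- Gluing: $c_2$ is disintegrated over the middle coordinate and attached to $c_1$. The resulting
law on triples has both couplings as marginals, and its outer marginal is a coupling of $\zeta$ and
$\xi$. -/
theorem wass_triangle [StandardBorelSpace X] [Nonempty X] (ζ ν ξ : Measure X)
    [IsProbabilityMeasure ζ] [IsProbabilityMeasure ν] :
    wass ζ ξ ≤ wass ζ ν + wass ν ξ := by
  have key : ∀ c₁, IsCoupling ζ ν c₁ → ∀ c₂, IsCoupling ν ξ c₂ →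
      wass ζ ξ ≤ ∫⁻ p, edist p.1 p.2 ∂c₁ + ∫⁻ p, edist p.1 p.2 ∂c₂ := by
    intro c₁ h₁ c₂ h₂
    have := h₁.isProbabilityMeasure
    have := h₂.isProbabilityMeasure
    set τ : Measure ((X × X) × X) := c₁ ⊗ₘ (c₂.condKernel.comap Prod.snd measurable_snd) with hτ
    have hm12 : Measurable fun q : (X × X) × X => (q.1.2, q.2) := by fun_prop
    have hm02 : Measurable fun q : (X × X) × X => (q.1.1, q.2) := by fun_prop
    have hfst : τ.map Prod.fst = c₁ := Measure.fst_compProd _ _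
    have h12 : τ.map (fun q => (q.1.2, q.2)) = c₂ := by
      have hdis : (c₁.map Prod.snd) ⊗ₘ c₂.condKernel = c₂ := by
        rw [h₁.2, ← h₂.1]
        exact c₂.disintegrate c₂.condKernel
      refine Measure.ext_of_lintegral _ fun f hf => ?_
      rw [lintegral_map hf hm12, hτ, Measure.lintegral_compProd (by fun_prop)]
      conv_rhs => rw [← hdis]
      rw [Measure.lintegral_compProd hf, lintegral_map _ measurable_snd]
      · rfl
      · exact hf.lintegral_kernel_prod_right'
    have hc : IsCoupling ζ ξ (τ.map fun q => (q.1.1, q.2)) := by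
      constructor
      · rw [Measure.map_map measurable_fst hm02, ← h₁.1, ← hfst,
          Measure.map_map measurable_fst measurable_fst]
        rfl
      · rw [Measure.map_map measurable_snd hm02, ← h₂.2, ← h12,
          Measure.map_map measurable_snd hm12]
        rfl
    refine (wass_le_of_isCoupling hc).trans ?_
    rw [lintegral_map (by fun_prop) hm02]
    conv_rhs => rw [← hfst, ← h12]
    rw [lintegral_map (by fun_prop) measurable_fst, lintegral_map (by fun_prop) hm12,
      ← lintegral_add_left (by fun_prop)]
    exact lintegral_mono fun q => edist_triangle _ _ _
  unfold wass at key ⊢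
  refine ENNReal.le_of_forall_pos_le_add fun ε hε hlt => ?_
  have hε' : (0 : ℝ≥0∞) < ε / 2 := by simpa using hε.ne'
  have hlt' := ENNReal.add_lt_top.1 hlt
  obtain ⟨c₁, h₁⟩ := iInf_lt_iff.1 (ENNReal.lt_add_right hlt'.1.ne hε'.ne')
  obtain ⟨hc₁, h₁⟩ := iInf_lt_iff.1 h₁
  obtain ⟨c₂, h₂⟩ := iInf_lt_iff.1 (ENNReal.lt_add_right hlt'.2.ne hε'.ne')
  obtain ⟨hc₂, h₂⟩ := iInf_lt_iff.1 h₂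
  refine (key c₁ hc₁ c₂ hc₂).trans ((add_le_add h₁.le h₂.le).trans (le_of_eq ?_))
  rw [add_add_add_comm, ENNReal.add_halves]

/-- The elementary half of Kantorovich duality. -/
theorem enorm_integral_sub_le_wass {ζ ν : Measure X} [IsProbabilityMeasure ζ]
    [IsProbabilityMeasure ν] {f : X → ℝ} (hf : Measurable f) (hζ : Integrable f ζ)
    (hν : Integrable f ν) {K : ℝ≥0∞} (hK : K ≠ ∞)
    (hlip : ∀ x y, ‖f x - f y‖ₑ ≤ K * edist x y) :
    ‖∫ x, f x ∂ζ - ∫ x, f x ∂ν‖ₑ ≤ K * wass ζ ν := by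
  have key : ∀ c, IsCoupling ζ ν c →
      ‖∫ x, f x ∂ζ - ∫ x, f x ∂ν‖ₑ ≤ K * ∫⁻ p, edist p.1 p.2 ∂c := by
    intro c hc
    rw [hc.integral_sub hf hζ hν, ← lintegral_const_mul _ (by fun_prop)]
    exact (enorm_integral_le_lintegral_enorm _).trans (lintegral_mono fun p => hlip _ _)
  -- Dividing by $K$ is what brings the infimum over couplings to the right-hand side; for $K=0$ any
  -- one coupling suffices, here the product.
  rcases eq_or_ne K 0 with rfl | hK0
  · simpa using key _ (isCoupling_prod ζ ν)
  · rw [← ENNReal.div_le_iff' hK0 hK]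
    exact le_iInf₂ fun c hc => (ENNReal.div_le_iff' hK0 hK).2 (key c hc)

end Wasserstein

/-- Thickened indicators of a closed set are bounded and Lipschitz, so duality equates their
integrals. Letting the thickening shrink equates the measures on closed sets, a π-system generating
the Borel sets. No optimal coupling is needed. -/
theorem eq_of_wass_eq_zero {X : Type*} [MeasurableSpace X] [PseudoEMetricSpace X] [BorelSpace X]
    [SecondCountableTopology X] {ζ ν : Measure X} [IsProbabilityMeasure ζ]
    [IsProbabilityMeasure ν] (h : wass ζ ν = 0) : ζ = ν := by
  have key : ∀ F : Set X, IsClosed F → ζ F = ν F := by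
    intro F hF
    have hδ : ∀ k : ℕ, 0 < ((k : ℝ) + 1)⁻¹ := fun k => by positivity
    have hlim : Tendsto (fun k : ℕ => ((k : ℝ) + 1)⁻¹) atTop (𝓝 0) := by
      simpa using tendsto_one_div_add_atTop_nhds_zero_nat (𝕜 := ℝ)
    have hζ := tendsto_lintegral_thickenedIndicator_of_isClosed ζ hF hδ hlim
    have hν := tendsto_lintegral_thickenedIndicator_of_isClosed ν hF hδ hlim
    refine tendsto_nhds_unique hζ (hν.congr fun k => ?_)
    have hg1 := thickenedIndicator_le_one (hδ k) F
    set g := thickenedIndicator (hδ k) F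
    have hgm : Measurable fun x => (g x : ℝ) := by fun_prop
    have hint : ∀ (ξ : Measure X) [IsProbabilityMeasure ξ], Integrable (fun x => (g x : ℝ)) ξ := by
      intro ξ _
      refine Integrable.of_bound hgm.aestronglyMeasurable 1 (.of_forall fun x => ?_)
      rw [Real.norm_of_nonneg (NNReal.coe_nonneg _)]
      exact_mod_cast hg1 x
    have hlip : ∀ x y,
        ‖(g x : ℝ) - g y‖ₑ ≤ ((Real.toNNReal ((k : ℝ) + 1)⁻¹)⁻¹ : ℝ≥0) * edist x y := by
      intro x y
      have := lipschitzWith_thickenedIndicator (hδ k) F x y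
      rw [← edist_eq_enorm_sub]
      exact this
    have := enorm_integral_sub_le_wass (ζ := ζ) (ν := ν) hgm (hint ζ) (hint ν)
      ENNReal.coe_ne_top hlip
    rw [h, mul_zero, nonpos_iff_eq_zero, enorm_eq_zero, sub_eq_zero] at this
    have hl : ∀ (ξ : Measure X) [IsProbabilityMeasure ξ],
        ENNReal.ofReal (∫ x, (g x : ℝ) ∂ξ) = ∫⁻ x, g x ∂ξ := by
      intro ξ _
      rw [ofReal_integral_eq_lintegral_ofReal (hint ξ) (.of_forall fun x => NNReal.coe_nonneg _)]
      simp
    rw [← hl ζ, ← hl ν, this]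
  exact ext_of_generate_finite _
    ((BorelSpace.measurable_eq (α := X)).trans borel_eq_generateFrom_isClosed)
    isPiSystem_isClosed (fun F hF => key F hF) (by simp)

end TDPO

namespace TDPO

/-! ### Gradients of functions on convex sets -/

section Gradient

variable {d : ℕ} {X : Set (E d)}

theorem extend_val (f : X → ℝ) (x : X) :
    Function.extend Subtype.val f 0 (x : E d) = f x :=
  Subtype.val_injective.extend_apply f 0 x

theorem DiffOn.hasFDerivAt {f : X → ℝ} (hf : DiffOn f) {x : X} (hx : (x : E d) ∈ interior X) :
    HasFDerivAt (Function.extend Subtype.val f 0) (InnerProductSpace.toDual ℝ (E d) (gradOn f x))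
      (x : E d) := by
  have h := (hf x x.2).hasGradientWithinAt.hasFDerivWithinAt
  exact h.hasFDerivAt (mem_interior_iff_mem_nhds.1 hx)

/-- A bound on the gradient in the interior of a convex body is a Lipschitz constant. -/
theorem DiffOn.enorm_sub_le (hX : Convex ℝ X) (hint : (interior X).Nonempty) {f : X → ℝ}
    (hf : DiffOn f) {C : ℝ≥0∞} (hC : C ≠ ∞)
    (hbound : ∀ x : X, (x : E d) ∈ interior X → ‖gradOn f x‖ₑ ≤ C) (x y : X) :
    ‖f x - f y‖ₑ ≤ C * edist x y := by
  lift C to ℝ≥0 using hC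
  set g := Function.extend Subtype.val f 0 with hg
  have hlip : LipschitzOnWith C g (interior X) := by
    refine hX.interior.lipschitzOnWith_of_nnnorm_hasFDerivWithin_le
      (f' := fun z => fderiv ℝ g z) (fun z hz => ?_) (fun z hz => ?_)
    · exact (hf.hasFDerivAt (x := ⟨z, interior_subset hz⟩) hz).differentiableAt.hasFDerivAt
        |>.hasFDerivWithinAt
    · rw [(hf.hasFDerivAt (x := ⟨z, interior_subset hz⟩) hz).fderiv]
      have := hbound ⟨z, interior_subset hz⟩ hz
      rw [enorm_eq_nnnorm, ENNReal.coe_le_coe] at this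
      simpa using this
  -- The mean value inequality covers the interior only. A convex set with non-empty interior lies
  -- in the closure of that interior, so continuity on `X` extends the estimate to boundary points.
  have hcl : X ⊆ closure (interior X) := by
    rw [hX.closure_interior_eq_closure_of_nonempty_interior hint]
    exact subset_closure
  have hlim : ∀ z : X, Tendsto g (𝓝[interior X] (z : E d)) (𝓝 (f z)) := by
    intro z
    rw [← extend_val f z]
    exact ((DifferentiableOn.continuousOn hf) z z.2).mono_left
      (nhdsWithin_mono _ interior_subset)
  have hne : ∀ z : X, (𝓝[interior X] (z : E d)).NeBot := fun z =>
    mem_closure_iff_nhdsWithin_neBot.1 (hcl z.2)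
  have := hne x
  have := hne y
  rw [← edist_eq_enorm_sub]
  have h1 : Tendsto (fun p : E d × E d => edist (g p.1) (g p.2))
      (𝓝[interior X] (x : E d) ×ˢ 𝓝[interior X] (y : E d)) (𝓝 (edist (f x) (f y))) :=
    ((hlim x).comp tendsto_fst).edist ((hlim y).comp tendsto_snd)
  have h2 : Tendsto (fun p : E d × E d => (C : ℝ≥0∞) * edist p.1 p.2)
      (𝓝[interior X] (x : E d) ×ˢ 𝓝[interior X] (y : E d)) (𝓝 (C * edist x y)) := by
    refine ENNReal.Tendsto.const_mul ?_ (Or.inr ENNReal.coe_ne_top)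
    exact Tendsto.edist (tendsto_fst.mono_right nhdsWithin_le_nhds)
      (tendsto_snd.mono_right nhdsWithin_le_nhds)
  refine le_of_tendsto_of_tendsto h1 h2 ?_
  filter_upwards [prod_mem_prod self_mem_nhdsWithin self_mem_nhdsWithin] with p hp
  exact hlip hp.1 hp.2

theorem DiffOn.enorm_sub_le_lipConst (hX : Convex ℝ X) (hint : (interior X).Nonempty)
    {f : X → ℝ} (hf : DiffOn f) (hC : lipConst f ≠ ∞) (x y : X) :
    ‖f x - f y‖ₑ ≤ lipConst f * edist x y :=
  hf.enorm_sub_le hX hint hC (fun z _ => le_iSup (fun z => ‖gradOn f z‖ₑ) z) x y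

theorem extend_sub (f g : X → ℝ) :
    Function.extend Subtype.val (fun x => f x - g x) (0 : E d → ℝ) =
      Function.extend Subtype.val f 0 - Function.extend Subtype.val g 0 := by
  classical
  ext z
  by_cases hz : ∃ a : X, (a : E d) = z
  · obtain ⟨a, rfl⟩ := hz
    simp
  · simp [Function.extend_apply' _ _ _ hz]

theorem DiffOn.sub {f g : X → ℝ} (hf : DiffOn f) (hg : DiffOn g) :
    DiffOn fun x => f x - g x := by
  unfold DiffOn
  rw [extend_sub]
  exact DifferentiableOn.sub hf hg

theorem gradOn_sub {f g : X → ℝ} (hf : DiffOn f) (hg : DiffOn g) {x : X}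
    (hx : (x : E d) ∈ interior X) :
    gradOn (fun x => f x - g x) x = gradOn f x - gradOn g x := by
  apply (InnerProductSpace.toDual ℝ (E d)).injective
  have h1 := (hf.sub hg).hasFDerivAt hx
  have h2 := (hf.hasFDerivAt hx).sub (hg.hasFDerivAt hx)
  rw [extend_sub] at h1
  rw [map_sub]
  exact h1.unique h2

open Classical in
/-- The point `x + h e_j` of `X`, or `x` if `x + h e_j` is not in `X`. -/
noncomputable def coordLine (x : X) (j : Fin d) (h : ℝ) : X :=
  if hm : (x : E d) + h • EuclideanSpace.single j (1 : ℝ) ∈ X then ⟨_, hm⟩ else x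

theorem continuous_add_smul_single (x : E d) (j : Fin d) :
    Continuous fun h : ℝ => x + h • (EuclideanSpace.single j (1 : ℝ) : E d) := by
  fun_prop

theorem eventually_coe_coordLine {x : X} (hx : (x : E d) ∈ interior X) (j : Fin d) :
    ∀ᶠ h in 𝓝[≠] (0 : ℝ),
      (coordLine x j h : E d) = (x : E d) + h • EuclideanSpace.single j (1 : ℝ) := by
  refine nhdsWithin_le_nhds ?_
  have hc := (continuous_add_smul_single (x : E d) j).tendsto 0
  simp only [zero_smul, add_zero] at hc
  filter_upwards [hc (mem_interior_iff_mem_nhds.1 hx)] with h hh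
  have hh' : (x : E d) + h • EuclideanSpace.single j (1 : ℝ) ∈ X := hh
  simp [coordLine, hh']

theorem tendsto_coordLine {x : X} (hx : (x : E d) ∈ interior X) (j : Fin d) :
    Tendsto (coordLine x j) (𝓝[≠] (0 : ℝ))
      (𝓝[{x' : X | x' ≠ x ∧
        ∃ h : ℝ, (x' : E d) = (x : E d) + h • EuclideanSpace.single j 1}] x) := by
  refine tendsto_nhdsWithin_iff.2 ⟨?_, ?_⟩
  · rw [tendsto_subtype_rng]
    have hc := (continuous_add_smul_single (x : E d) j).tendsto 0
    simp only [zero_smul, add_zero] at hc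
    refine (hc.mono_left nhdsWithin_le_nhds).congr' ?_
    filter_upwards [eventually_coe_coordLine hx j] with h hh using hh.symm
  · filter_upwards [eventually_coe_coordLine hx j, self_mem_nhdsWithin] with h hh h0
    refine ⟨fun he => h0 ?_, h, hh⟩
    rw [he] at hh
    simpa using hh

theorem eventually_edist_coordLine {x : X} (hx : (x : E d) ∈ interior X) (j : Fin d) :
    ∀ᶠ h in 𝓝[≠] (0 : ℝ), edist (coordLine x j h) x = ‖h‖ₑ := by
  filter_upwards [eventually_coe_coordLine hx j] with h hh
  rw [Subtype.edist_eq, hh, edist_eq_enorm_sub]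
  have h1 : ‖(EuclideanSpace.single j (1 : ℝ) : E d)‖ₑ = 1 := by
    rw [← ofReal_norm, PiLp.norm_single]
    simp
  rw [add_sub_cancel_left, enorm_smul, h1, mul_one]

theorem DiffOn.tendsto_slope {f : X → ℝ} (hf : DiffOn f) {x : X}
    (hx : (x : E d) ∈ interior X) (j : Fin d) :
    Tendsto (fun h => (f (coordLine x j h) - f x) / h) (𝓝[≠] (0 : ℝ)) (𝓝 (gradOn f x j)) := by
  have h1 : HasDerivAt (fun h : ℝ => (x : E d) + h • (EuclideanSpace.single j (1 : ℝ) : E d))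
      (EuclideanSpace.single j (1 : ℝ)) 0 := by
    simpa using ((hasDerivAt_id (0 : ℝ)).smul_const
      (EuclideanSpace.single j (1 : ℝ) : E d)).const_add (x : E d)
  have h2 : HasFDerivAt (Function.extend Subtype.val f 0)
      (InnerProductSpace.toDual ℝ (E d) (gradOn f x))
      ((x : E d) + (0 : ℝ) • (EuclideanSpace.single j (1 : ℝ) : E d)) := by
    simpa using hf.hasFDerivAt hx
  have h3 := hasDerivAt_iff_tendsto_slope.1 (h2.comp_hasDerivAt (0 : ℝ) h1)
  have h4 : (InnerProductSpace.toDual ℝ (E d) (gradOn f x)) (EuclideanSpace.single j (1 : ℝ)) =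
      gradOn f x j := by
    simp [InnerProductSpace.toDual_apply_apply, EuclideanSpace.inner_single_right]
  rw [h4] at h3
  refine h3.congr' ?_
  filter_upwards [eventually_coe_coordLine hx j] with h hh
  simp only [slope, Function.comp, vsub_eq_sub, sub_zero, zero_smul, add_zero, smul_eq_mul,
    ← hh, extend_val]
  ring

theorem enorm_eq_rpow_sum (v : E d) : ‖v‖ₑ = (∑ j, ‖v j‖ₑ ^ 2) ^ (1 / 2 : ℝ) := by
  rw [← ofReal_norm, EuclideanSpace.norm_eq, Real.sqrt_eq_rpow,
    ← ENNReal.ofReal_rpow_of_nonneg (by positivity) (by norm_num),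
    ENNReal.ofReal_sum_of_nonneg (fun _ _ => by positivity)]
  congr 1
  refine Finset.sum_congr rfl fun j _ => ?_
  rw [ENNReal.ofReal_pow (norm_nonneg _), ofReal_norm]

end Gradient

end TDPO

namespace TDPO

namespace MDP

/-! ### Bellman equation and performance difference -/

section Bellman

variable {n m : ℕ} {S : Set (E n)} {A : Set (E m)} (M : MDP S A) (π : Policy S A)

/-- The state transition kernel of the policy `π`. -/
noncomputable def trans : Kernel S S := M.P ∘ₖ (Kernel.id ×ₖ π.toKernel)

instance : IsMarkovKernel (M.trans π) := by
  unfold trans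
  infer_instance

/-- The `t`-step transition kernel of the policy `π`. -/
noncomputable def iter : ℕ → Kernel S S
  | 0 => Kernel.id
  | t + 1 => M.trans π ∘ₖ iter t

instance isMarkovKernel_iter (t : ℕ) : IsMarkovKernel (M.iter π t) := by
  induction t with
  | zero => unfold iter; infer_instance
  | succ t ih => unfold iter; infer_instance

/-- Writing the law at time $t$ as a mixture of kernels over the initial state is what makes it
measurable in that state and allows Fubini. -/
theorem steps_eq_bind (ν : Measure S) (t : ℕ) : M.steps ν π t = ν.bind (M.iter π t) := by
  induction t with
  | zero => simp [steps, iter]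
  | succ t ih =>
    rw [steps, ih, step, iter]
    exact Measure.comp_assoc

theorem steps_dirac (s : S) (t : ℕ) : M.steps (Measure.dirac s) π t = M.iter π t s := by
  rw [steps_eq_bind, Measure.dirac_bind (Kernel.measurable _)]

instance isProbabilityMeasure_steps (ν : Measure S) [IsProbabilityMeasure ν] (t : ℕ) :
    IsProbabilityMeasure (M.steps ν π t) := by
  rw [steps_eq_bind]
  infer_instance

instance isProbabilityMeasure_step (ν : Measure S) [IsProbabilityMeasure ν] :
    IsProbabilityMeasure (M.step ν π) :=
  inferInstanceAs (IsProbabilityMeasure (ν.bind (M.trans π)))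

/-- The recursion defining `steps` peels off the last transition; the Bellman equation needs the
first. -/
theorem steps_succ' (ν : Measure S) (t : ℕ) :
    M.steps ν π (t + 1) = M.steps (M.step ν π) π t := by
  induction t with
  | zero => rfl
  | succ t ih => rw [steps, ih]; rfl

theorem integrable_of_bounded {X : Type*} [MeasurableSpace X] {ν : Measure X}
    [IsFiniteMeasure ν] {f : X → ℝ} (hf : Measurable f) {C : ℝ} (hC : ∀ x, |f x| ≤ C) :
    Integrable f ν :=
  Integrable.of_bound hf.aestronglyMeasurable C (.of_forall hC)

theorem abs_integral_le_of_bounded {X : Type*} [MeasurableSpace X] {ν : Measure X}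
    [IsProbabilityMeasure ν] {f : X → ℝ} {C : ℝ} (hC : ∀ x, |f x| ≤ C) :
    |∫ x, f x ∂ν| ≤ C := by
  simpa using norm_integral_le_of_norm_le_const (μ := ν) (.of_forall hC : ∀ᵐ x ∂ν, ‖f x‖ ≤ C)

/-- The expected one-step reward of the policy `π`. -/
noncomputable def reward (s : S) : ℝ := ∫ a, M.R (s, a) ∂(π.toKernel s)

theorem abs_R_le (x : S × A) : |M.R x| ≤ M.Rmax :=
  abs_le.2 ⟨by linarith [(M.R_mem x).1, (M.R_mem x).2], (M.R_mem x).2⟩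

theorem measurable_integral_policy {f : S × A → ℝ} (hf : Measurable f) :
    Measurable fun s => ∫ a, f (s, a) ∂(π.toKernel s) :=
  (hf.stronglyMeasurable.integral_kernel_prod_right' (κ := π.toKernel)).measurable

theorem measurable_reward : Measurable (M.reward π) :=
  measurable_integral_policy π M.measurable_R

theorem abs_reward_le (s : S) : |M.reward π s| ≤ M.Rmax :=
  abs_integral_le_of_bounded fun _ => M.abs_R_le _

theorem summable_discount {f : ℕ → ℝ} {C : ℝ} (hf : ∀ t, |f t| ≤ C) :
    Summable fun t => M.γ ^ t * f t := by
  refine Summable.of_norm_bounded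
    ((summable_geometric_of_lt_one M.γ_nonneg M.γ_lt_one).mul_right C) fun t => ?_
  rw [Real.norm_eq_abs, abs_mul, abs_of_nonneg (pow_nonneg M.γ_nonneg t)]
  exact mul_le_mul_of_nonneg_left (hf t) (pow_nonneg M.γ_nonneg t)

theorem V_eq (s : S) : M.V π s = ∑' t, M.γ ^ t * ∫ s', M.reward π s' ∂(M.iter π t s) := by
  simp only [V, steps_dirac, reward]

theorem measurable_V : Measurable (M.V π) := by
  have : M.V π = fun s => ∑' t, M.γ ^ t * ∫ s', M.reward π s' ∂(M.iter π t s) :=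
    funext (M.V_eq π)
  rw [this]
  have hm : ∀ t, Measurable fun s => M.γ ^ t * ∫ s', M.reward π s' ∂(M.iter π t s) := fun t =>
    ((M.measurable_reward π).stronglyMeasurable.integral_kernel
      (κ := M.iter π t)).measurable.const_mul _
  have hs : ∀ s, HasSum (fun t => M.γ ^ t * ∫ s', M.reward π s' ∂(M.iter π t s))
      (∑' t, M.γ ^ t * ∫ s', M.reward π s' ∂(M.iter π t s)) := fun s =>
    (M.summable_discount fun t => abs_integral_le_of_bounded (M.abs_reward_le π)).hasSum
  exact measurable_of_tendsto_metrizable (fun k => Finset.measurable_sum _ fun t _ => hm t)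
    (tendsto_pi_nhds.2 fun s => (hs s).tendsto_sum_nat)

theorem abs_V_le (s : S) : |M.V π s| ≤ M.Rmax * (1 - M.γ)⁻¹ := by
  rw [V_eq, ← tsum_geometric_of_lt_one M.γ_nonneg M.γ_lt_one, ← tsum_mul_left]
  rw [← Real.norm_eq_abs]
  refine tsum_of_norm_bounded
    ((summable_geometric_of_lt_one M.γ_nonneg M.γ_lt_one).mul_left M.Rmax).hasSum fun t => ?_
  rw [Real.norm_eq_abs, abs_mul, abs_of_nonneg (pow_nonneg M.γ_nonneg t), mul_comm]
  exact mul_le_mul_of_nonneg_right (abs_integral_le_of_bounded (M.abs_reward_le π))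
    (pow_nonneg M.γ_nonneg t)

theorem integral_bind {X Y : Type*} [MeasurableSpace X] [MeasurableSpace Y] (ν : Measure X)
    [IsProbabilityMeasure ν] (K : Kernel X Y) [IsMarkovKernel K] {f : Y → ℝ} (hf : Measurable f)
    {C : ℝ} (hC : ∀ y, |f y| ≤ C) :
    ∫ y, f y ∂(ν.bind K) = ∫ x, ∫ y, f y ∂(K x) ∂ν := by
  have h : Integrable f ((K ∘ₖ Kernel.const Unit ν) ()) := integrable_of_bounded hf hC
  have h2 := Kernel.integral_comp h
  rwa [Kernel.comp_apply, Kernel.const_apply] at h2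

theorem integral_steps (ν : Measure S) [IsProbabilityMeasure ν] {f : S → ℝ} (hf : Measurable f)
    {C : ℝ} (hC : ∀ s, |f s| ≤ C) (t : ℕ) :
    ∫ s, f s ∂(M.steps ν π t) = ∫ s, ∫ s', f s' ∂(M.iter π t s) ∂ν := by
  rw [steps_eq_bind]
  exact integral_bind ν _ hf hC

theorem integral_V (ν : Measure S) [IsProbabilityMeasure ν] :
    ∫ s, M.V π s ∂ν = ∑' t, M.γ ^ t * ∫ s, M.reward π s ∂(M.steps ν π t) := by
  have hb : ∀ t s, |∫ s', M.reward π s' ∂(M.iter π t s)| ≤ M.Rmax := fun t s =>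
    abs_integral_le_of_bounded (M.abs_reward_le π)
  have hi : ∀ t, Integrable (fun s => ∫ s', M.reward π s' ∂(M.iter π t s)) ν := fun t =>
    integrable_of_bounded ((M.measurable_reward π).stronglyMeasurable.integral_kernel
      (κ := M.iter π t)).measurable (hb t)
  simp only [V_eq]
  rw [← integral_tsum_of_summable_integral_norm]
  · refine tsum_congr fun t => ?_
    rw [integral_const_mul, M.integral_steps π ν (M.measurable_reward π) (M.abs_reward_le π)]
  · exact fun t => (hi t).const_mul _
  · have : (fun t => ∫ s, ‖M.γ ^ t * ∫ s', M.reward π s' ∂(M.iter π t s)‖ ∂ν) =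
        fun t => M.γ ^ t * ∫ s, |∫ s', M.reward π s' ∂(M.iter π t s)| ∂ν := by
      ext t
      rw [← integral_const_mul]
      congr with s
      rw [Real.norm_eq_abs, abs_mul, abs_of_nonneg (pow_nonneg M.γ_nonneg t)]
    rw [this]
    refine M.summable_discount (C := M.Rmax) fun t => abs_integral_le_of_bounded fun s => ?_
    rw [abs_abs]
    exact hb t s

theorem measurable_Q : Measurable fun x : S × A => M.Q π x.1 x.2 := by
  unfold Q
  have h := ((M.measurable_V π).stronglyMeasurable.integral_kernel (κ := M.P)).measurable
  exact M.measurable_R.add (h.const_mul _)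

theorem measurable_Q_action (s : S) : Measurable fun a : A => M.Q π s a :=
  (M.measurable_Q π).comp (by fun_prop : Measurable fun a : A => (s, a))

/-- A uniform bound for the action values. -/
noncomputable def boundQ : ℝ := M.Rmax + M.γ * (M.Rmax * (1 - M.γ)⁻¹)

theorem abs_Q_le (s : S) (a : A) : |M.Q π s a| ≤ M.boundQ := by
  unfold Q boundQ
  refine (abs_add_le _ _).trans (add_le_add (M.abs_R_le _) ?_)
  rw [abs_mul, abs_of_nonneg M.γ_nonneg]
  exact mul_le_mul_of_nonneg_left (abs_integral_le_of_bounded (M.abs_V_le π)) M.γ_nonneg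

theorem integrable_Q (s : S) (ν : Measure A) [IsFiniteMeasure ν] :
    Integrable (fun a => M.Q π s a) ν :=
  integrable_of_bounded (M.measurable_Q_action π s) (M.abs_Q_le π s)

theorem integral_trans {f : S → ℝ} (hf : Measurable f) {C : ℝ} (hC : ∀ s, |f s| ≤ C) (s : S) :
    ∫ s', f s' ∂(M.trans π s) = ∫ a, ∫ s', f s' ∂(M.P (s, a)) ∂(π.toKernel s) := by
  rw [trans, Kernel.integral_comp (integrable_of_bounded hf hC), Kernel.prod_apply,
    Kernel.id_apply, integral_prod, integral_dirac]
  exact integrable_of_bounded (hf.stronglyMeasurable.integral_kernel (κ := M.P)).measurable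
    (fun x => abs_integral_le_of_bounded hC)

theorem integral_Q (π' : Policy S A) (s : S) :
    ∫ a, M.Q π s a ∂(π'.toKernel s) =
      M.reward π' s + M.γ * ∫ s', M.V π s' ∂(M.trans π' s) := by
  unfold Q
  rw [integral_add, integral_const_mul,
    M.integral_trans π' (M.measurable_V π) (M.abs_V_le π)]
  · rfl
  · exact integrable_of_bounded
      (M.measurable_R.comp (by fun_prop : Measurable fun a : A => (s, a))) fun a => M.abs_R_le _
  · refine Integrable.const_mul (integrable_of_bounded
      (((M.measurable_V π).stronglyMeasurable.integral_kernel (κ := M.P)).measurable.comp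
        (by fun_prop : Measurable fun a : A => (s, a)))
      fun a => abs_integral_le_of_bounded (M.abs_V_le π)) _

/-- The Bellman equation. -/
theorem V_eq_integral_Q (s : S) : M.V π s = ∫ a, M.Q π s a ∂(π.toKernel s) := by
  rw [integral_Q, V_eq, Summable.tsum_eq_zero_add
    (M.summable_discount fun t => abs_integral_le_of_bounded (M.abs_reward_le π))]
  congr 1
  · simp only [pow_zero, one_mul, iter, Kernel.id_apply]
    exact integral_dirac' _ _ (M.measurable_reward π).stronglyMeasurable
  · rw [integral_V, ← tsum_mul_left]
    refine tsum_congr fun t => ?_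
    rw [← steps_dirac, steps_succ', pow_succ', mul_assoc]
    congr 4
    rw [step, Measure.dirac_bind (Kernel.measurable _)]
    rfl

theorem adv_eq (π' : Policy S A) (s : S) :
    M.adv π s π' = ∫ a, M.Q π s a ∂(π'.toKernel s) - ∫ a, M.Q π s a ∂(π.toKernel s) := by
  unfold adv
  rw [integral_sub (M.integrable_Q π s _) (integrable_const _), M.V_eq_integral_Q]
  simp

theorem adv_self (s : S) : M.adv π s π = 0 := by
  rw [adv_eq, sub_self]

theorem adv_eq_reward (π' : Policy S A) (s : S) :
    M.adv π s π' = M.reward π' s + M.γ * ∫ s', M.V π s' ∂(M.trans π' s) - M.V π s := by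
  rw [adv_eq, ← V_eq_integral_Q, integral_Q]

theorem measurable_adv (π' : Policy S A) : Measurable fun s => M.adv π s π' := by
  simp only [adv_eq]
  exact (measurable_integral_policy π' (M.measurable_Q π)).sub
    (measurable_integral_policy π (M.measurable_Q π))

theorem abs_adv_le (π' : Policy S A) (s : S) : |M.adv π s π'| ≤ M.boundQ + M.boundQ := by
  rw [adv_eq]
  exact (abs_sub _ _).trans (add_le_add (abs_integral_le_of_bounded (M.abs_Q_le π s))
    (abs_integral_le_of_bounded (M.abs_Q_le π s)))

theorem integrable_adv (π' : Policy S A) (ν : Measure S) [IsFiniteMeasure ν] :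
    Integrable (fun s => M.adv π s π') ν :=
  integrable_of_bounded (M.measurable_adv π π') (M.abs_adv_le π π')

theorem summable_adv (π' π'' : Policy S A) :
    Summable fun t => M.γ ^ t * ∫ s, M.adv π s π' ∂(M.steps M.μ π'' t) :=
  M.summable_discount fun _ => abs_integral_le_of_bounded (M.abs_adv_le π π')

/-- The performance difference formula. -/
theorem payoff_sub_payoff (π' : Policy S A) :
    M.payoff π' - M.payoff π = ∑' t, M.γ ^ t * ∫ s, M.adv π s π' ∂(M.steps M.μ π' t) := by
  set v : ℕ → ℝ := fun t => M.γ ^ t * ∫ s, M.V π s ∂(M.steps M.μ π' t) with hv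
  have hvs : Summable v :=
    M.summable_discount fun t => abs_integral_le_of_bounded (M.abs_V_le π)
  have hrs : Summable fun t => M.γ ^ t * ∫ s, M.reward π' s ∂(M.steps M.μ π' t) :=
    M.summable_discount fun t => abs_integral_le_of_bounded (M.abs_reward_le π')
  -- The advantage is $r+\gamma\,\mathbb E V-V$, so the value terms telescope and leave only
  -- $-v_0=-\eta_\pi$.
  have hterm : ∀ t, M.γ ^ t * ∫ s, M.adv π s π' ∂(M.steps M.μ π' t) =
      M.γ ^ t * ∫ s, M.reward π' s ∂(M.steps M.μ π' t) + (v (t + 1) - v t) := by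
    intro t
    have hint : Integrable (fun s => ∫ s', M.V π s' ∂(M.trans π' s)) (M.steps M.μ π' t) :=
      integrable_of_bounded ((M.measurable_V π).stronglyMeasurable.integral_kernel
        (κ := M.trans π')).measurable fun s => abs_integral_le_of_bounded (M.abs_V_le π)
    have hr : Integrable (M.reward π') (M.steps M.μ π' t) :=
      integrable_of_bounded (M.measurable_reward π') (M.abs_reward_le π')
    have hV : Integrable (M.V π) (M.steps M.μ π' t) :=
      integrable_of_bounded (M.measurable_V π) (M.abs_V_le π)
    have hstep : ∫ s, M.V π s ∂(M.steps M.μ π' (t + 1)) =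
        ∫ s, ∫ s', M.V π s' ∂(M.trans π' s) ∂(M.steps M.μ π' t) :=
      integral_bind _ (M.trans π') (M.measurable_V π) (M.abs_V_le π)
    simp only [adv_eq_reward, hv]
    have h1 : Integrable (fun s => M.reward π' s + M.γ * ∫ s', M.V π s' ∂(M.trans π' s))
        (M.steps M.μ π' t) := hr.add (hint.const_mul _)
    rw [integral_sub h1 hV, integral_add hr (hint.const_mul _), integral_const_mul, hstep]
    ring
  have hvs' : Summable fun t => v (t + 1) := (summable_nat_add_iff 1).2 hvs
  rw [tsum_congr hterm, hrs.tsum_add (hvs'.sub hvs), hvs'.tsum_sub hvs, hvs.tsum_eq_zero_add]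
  unfold payoff
  rw [integral_V M π' M.μ]
  simp only [hv, pow_zero, one_mul, steps]
  ring

theorem integral_visit (π' : Policy S A) :
    (1 - M.γ)⁻¹ * ∫ s, M.adv π s π' ∂(M.visit M.μ π) =
      ∑' t, M.γ ^ t * ∫ s, M.adv π s π' ∂(M.steps M.μ π t) := by
  have hγ : 0 < 1 - M.γ := sub_pos.2 M.γ_lt_one
  have hw : ∀ t, 0 ≤ (1 - M.γ) * M.γ ^ t := fun t =>
    mul_nonneg hγ.le (pow_nonneg M.γ_nonneg t)
  have hint : Integrable (fun s => M.adv π s π') (M.visit M.μ π) := by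
    refine integrable_sum_measure
      (fun t => (M.integrable_adv π π' _).smul_measure ENNReal.ofReal_ne_top) ?_
    simp only [integral_smul_measure, ENNReal.toReal_ofReal (hw _), smul_eq_mul, mul_assoc]
    refine (M.summable_discount (C := M.boundQ + M.boundQ) fun t =>
      abs_integral_le_of_bounded fun s => ?_).mul_left _
    rw [Real.norm_eq_abs, abs_abs]
    exact M.abs_adv_le π π' s
  unfold visit at hint ⊢
  rw [integral_sum_measure hint, ← tsum_mul_left]
  refine tsum_congr fun t => ?_
  rw [integral_smul_measure, ENNReal.toReal_ofReal (hw t), smul_eq_mul, mul_assoc,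
    inv_mul_cancel_left₀ hγ.ne']

end Bellman

end MDP

end TDPO

namespace TDPO

/-! ### Divergence of the state distributions -/

theorem one_add_mul_inv_one_sub (q : ℝ≥0∞) : 1 + q * (1 - q)⁻¹ = (1 - q)⁻¹ := by
  have h : ∑' k : ℕ, q ^ k = 1 + q * ∑' k : ℕ, q ^ k := by
    rw [← ENNReal.tsum_mul_left, tsum_eq_zero_add' ENNReal.summable, pow_zero]
    simp only [pow_succ']
  rw [← ENNReal.tsum_geometric, ← h]

/-- Induction on partial sums: the bound $B$ is a fixed point of $B=\frac{gb}{1-g}+gq\,B$. In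
$[0,\infty]$ this identity survives $g\ge1$ or $gq\ge1$, so no smallness is assumed. -/
theorem tsum_pow_mul_le_of_le_add {g b q : ℝ≥0∞} {w : ℕ → ℝ≥0∞} (h0 : w 0 = 0)
    (hw : ∀ t, w (t + 1) ≤ b + q * w t) :
    ∑' t, g ^ t * w t ≤ g * b * (1 - g)⁻¹ * (1 - g * q)⁻¹ := by
  rw [ENNReal.tsum_eq_iSup_nat]
  refine iSup_le fun N => ?_
  induction N with
  | zero => simp
  | succ N ih =>
    have hgeom : ∑ t ∈ Finset.range N, g ^ t ≤ (1 - g)⁻¹ := by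
      rw [← ENNReal.tsum_geometric]
      exact ENNReal.sum_le_tsum _
    calc ∑ t ∈ Finset.range (N + 1), g ^ t * w t
        = ∑ t ∈ Finset.range N, g ^ (t + 1) * w (t + 1) := by
          rw [Finset.sum_range_succ', h0, mul_zero, add_zero]
      _ ≤ ∑ t ∈ Finset.range N, (g * b * g ^ t + g * q * (g ^ t * w t)) := by
          refine Finset.sum_le_sum fun t _ => (mul_le_mul_right (hw t) _).trans (le_of_eq ?_)
          ring
      _ = g * b * ∑ t ∈ Finset.range N, g ^ t + g * q * ∑ t ∈ Finset.range N, g ^ t * w t := by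
          rw [Finset.sum_add_distrib, Finset.mul_sum, Finset.mul_sum]
      _ ≤ g * b * (1 - g)⁻¹ + g * q * (g * b * (1 - g)⁻¹ * (1 - g * q)⁻¹) := by gcongr
      _ = g * b * (1 - g)⁻¹ * (1 + g * q * (1 - g * q)⁻¹) := by ring
      _ = g * b * (1 - g)⁻¹ * (1 - g * q)⁻¹ := by rw [one_add_mul_inv_one_sub]

/-- For $0<b<\infty$ the set is the single ratio $a/b$; for $b=0$ the a priori bound forces $a=0$.
The claim fails for $a=b=\infty$, where the infimum is $0$. -/
theorem le_sInf_setOf_eq_mul {a b L : ℝ≥0∞} (hb : b ≠ ∞) (hab : a ≤ L * b) :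
    a ≤ sInf {x | a = x * b} * b := by
  rcases eq_or_ne b 0 with rfl | hb0
  · simpa using hab
  · have : {x | a = x * b} = {a / b} := by
      ext x
      rw [Set.mem_ofPred_eq, Set.mem_singleton_iff, ENNReal.eq_div_iff hb0 hb, mul_comm, eq_comm]
    rw [this, csInf_singleton, ENNReal.div_mul_cancel hb0 hb]

namespace MDP

variable {n m : ℕ} {S : Set (E n)} {A : Set (E m)} (M : MDP S A)

/-- The summand $k=1$ is $\hat L^{(t)}$; every later summand contains the factor $i=1$, which is
$\tilde L^{(t)}$. -/
theorem CLt_succ (ν : Measure S) (π₁ π₂ : Policy S A) (t : ℕ) :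
    M.CLt ν π₁ π₂ (t + 1) =
      M.hatL ν π₁ π₂ t + M.tildeL ν π₁ π₂ t * M.CLt ν π₁ π₂ t := by
  have h : ∀ (N : ℕ) (u : ℕ → ℝ≥0∞), ∑ k ∈ Finset.Icc 1 N, u k =
      ∑ k ∈ Finset.range N, u (k + 1) := by
    intro N u
    rw [Finset.range_eq_Ico, Finset.sum_Ico_add' u 0 N 1]
    rfl
  have hp : ∀ (N : ℕ) (u : ℕ → ℝ≥0∞), ∏ k ∈ Finset.Icc 1 N, u k =
      ∏ k ∈ Finset.range N, u (k + 1) := by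
    intro N u
    rw [Finset.range_eq_Ico, Finset.prod_Ico_add' u 0 N 1]
    rfl
  unfold CLt
  rw [h, h, Finset.sum_range_succ', Finset.mul_sum, add_comm]
  congr 1
  · simp
  · refine Finset.sum_congr rfl fun k _ => ?_
    rw [hp, hp]
    simp only [Nat.add_sub_cancel]
    rw [Finset.prod_range_succ']
    simp only [Nat.add_sub_add_right, zero_add, Nat.add_sub_cancel]
    ring

theorem ofReal_discount_ratio :
    ENNReal.ofReal (M.γ / (1 - M.γ)) = ENNReal.ofReal M.γ * (1 - ENNReal.ofReal M.γ)⁻¹ := by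
  have h : 0 < 1 - M.γ := sub_pos.2 M.γ_lt_one
  rw [ENNReal.ofReal_div_of_pos h, ENNReal.ofReal_sub _ M.γ_nonneg, ENNReal.ofReal_one,
    div_eq_mul_inv]

variable [StandardBorelSpace S] [Nonempty S]

/-- The intermediate measure applies $\pi_2$ to the state law of $\pi_1$: one term changes only the
policy, the other only the state distribution. -/
theorem wass_steps_succ_le (ν : Measure S) [IsProbabilityMeasure ν] (π₁ π₂ : Policy S A) (t : ℕ) :
    wass (M.steps ν π₁ (t + 1)) (M.steps ν π₂ (t + 1)) ≤
      wass (M.step (M.steps ν π₁ t) π₁) (M.step (M.steps ν π₁ t) π₂) +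
        wass (M.step (M.steps ν π₁ t) π₂) (M.step (M.steps ν π₂ t) π₂) :=
  wass_triangle _ _ _

/-- Finiteness is carried through the induction because the ratio $\tilde L^{(t)}$ controls the next
distance only when the current one is finite. -/
theorem wass_steps_le_CLt {Pol : Set (Policy S A)} {Lπ Lμ : ℝ≥0}
    (hLπ : M.LipschitzPolicy Pol Lπ) (hLμ : M.LipschitzState Pol Lμ) (ν : Measure S)
    [IsProbabilityMeasure ν] {π₁ π₂ : Policy S A} (h₁ : π₁ ∈ Pol) (h₂ : π₂ ∈ Pol)
    (hW : policyW π₁ π₂ ≠ ∞) (t : ℕ) :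
    wass (M.steps ν π₁ t) (M.steps ν π₂ t) ≠ ∞ ∧
      wass (M.steps ν π₁ t) (M.steps ν π₂ t) ≤ M.CLt ν π₁ π₂ t * policyW π₁ π₂ := by
  induction t with
  | zero => simp [steps]
  | succ t ih =>
    obtain ⟨hfin, hle⟩ := ih
    have hstep := M.wass_steps_succ_le ν π₁ π₂ t
    have hp := hLπ (M.steps ν π₁ t) inferInstance π₁ h₁ π₂ h₂
    have hs := hLμ (M.steps ν π₁ t) (M.steps ν π₂ t) inferInstance inferInstance π₂ h₂
    refine ⟨ne_top_of_le_ne_top ?_ (hstep.trans (add_le_add hp hs)), ?_⟩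
    · exact ENNReal.add_ne_top.2 ⟨ENNReal.mul_ne_top ENNReal.coe_ne_top hW,
        ENNReal.mul_ne_top ENNReal.coe_ne_top hfin⟩
    · have hp' : _ ≤ M.hatL ν π₁ π₂ t * policyW π₁ π₂ := le_sInf_setOf_eq_mul hW hp
      have hs' : _ ≤ M.tildeL ν π₁ π₂ t * wass (M.steps ν π₁ t) (M.steps ν π₂ t) :=
        le_sInf_setOf_eq_mul hfin hs
      refine hstep.trans ((add_le_add hp' (hs'.trans (mul_le_mul_right hle _))).trans ?_)
      rw [CLt_succ, add_mul, mul_assoc]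

/-- The discounted sum of the distances between the state distributions of two policies. -/
theorem tsum_discount_wass_le {Pol : Set (Policy S A)} {Lπ Lμ : ℝ≥0}
    (hLπ : M.LipschitzPolicy Pol Lπ) (hLμ : M.LipschitzState Pol Lμ) {κ : ℝ≥0∞}
    (hκ : M.IsAmplification Pol Lπ Lμ κ) {π₁ π₂ : Policy S A} (h₁ : π₁ ∈ Pol) (h₂ : π₂ ∈ Pol) :
    ∑' t, ENNReal.ofReal M.γ ^ t * wass (M.steps M.μ π₁ t) (M.steps M.μ π₂ t) ≤
      ENNReal.ofReal (M.γ / (1 - M.γ)) * κ * policyW π₁ π₂ := by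
  have h0 : wass (M.steps M.μ π₁ 0) (M.steps M.μ π₂ 0) = 0 := by simp [steps]
  rw [ofReal_discount_ratio]
  rcases hκ with ⟨hlt, rfl⟩ | ⟨hW, -, rfl⟩
  · refine (tsum_pow_mul_le_of_le_add (b := Lπ * policyW π₁ π₂) (q := Lμ) h0 fun t => ?_).trans
      (le_of_eq ?_)
    · exact (M.wass_steps_succ_le M.μ π₁ π₂ t).trans
        (add_le_add (hLπ _ inferInstance π₁ h₁ π₂ h₂) (hLμ _ _ inferInstance inferInstance π₂ h₂))
    · rw [ENNReal.ofReal_div_of_pos (sub_pos.2 hlt),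
        ENNReal.ofReal_sub _ (mul_nonneg M.γ_nonneg Lμ.coe_nonneg), ENNReal.ofReal_mul M.γ_nonneg,
        ENNReal.ofReal_one, ENNReal.ofReal_coe_nnreal, ENNReal.ofReal_coe_nnreal, div_eq_mul_inv]
      ring
  -- The bound by $C_L W(\pi_1,\pi_2)$ is uniform in time, so the recursion is used with $q=0$.
  · refine (tsum_pow_mul_le_of_le_add (b := M.CL Pol * policyW π₁ π₂) (q := 0) h0
      fun t => ?_).trans (le_of_eq ?_)
    · refine (M.wass_steps_le_CLt hLπ hLμ M.μ h₁ h₂ (hW _ h₁ _ h₂) (t + 1)).2.trans ?_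
      rw [zero_mul, add_zero]
      refine mul_le_mul_left ?_ _
      unfold CL
      exact le_iSup_of_le M.μ <| le_iSup_of_le M.prob <| le_iSup₂_of_le π₁ h₁ <|
        le_iSup₂_of_le π₂ h₂ <| le_iSup (fun t => M.CLt M.μ π₁ π₂ t) (t + 1)
    · simp only [mul_zero, tsub_zero, inv_one, mul_one]
      ring

end MDP

end TDPO

namespace TDPO

/-! ### The advantage is Lipschitz in the state -/

theorem rpow_sum_mul_sq {ι : Type*} (s : Finset ι) (c : ℝ≥0∞) (x : ι → ℝ≥0∞) :
    (∑ j ∈ s, (c * x j) ^ 2) ^ (1 / 2 : ℝ) = c * (∑ j ∈ s, x j ^ 2) ^ (1 / 2 : ℝ) := by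
  simp only [mul_pow]
  rw [← Finset.mul_sum, ENNReal.mul_rpow_of_nonneg _ _ (by norm_num : (0 : ℝ) ≤ 1 / 2),
    ← ENNReal.rpow_natCast, ← ENNReal.rpow_mul]
  norm_num

theorem rpow_sum_add_sq_le {ι : Type*} (s : Finset ι) (x y : ι → ℝ≥0∞) :
    (∑ j ∈ s, (x j + y j) ^ 2) ^ (1 / 2 : ℝ) ≤
      (∑ j ∈ s, x j ^ 2) ^ (1 / 2 : ℝ) + (∑ j ∈ s, y j ^ 2) ^ (1 / 2 : ℝ) := by
  have h := ENNReal.Lp_add_le s x y (one_le_two : (1 : ℝ) ≤ 2)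
  simpa only [ENNReal.rpow_ofNat] using h

instance isProbabilityMeasure_mix {X : Type*} [MeasurableSpace X] (ζ ν : Measure X)
    [IsProbabilityMeasure ζ] [IsProbabilityMeasure ν] : IsProbabilityMeasure (mix ζ ν) := by
  refine ⟨?_⟩
  simp only [mix, Measure.smul_apply, Measure.add_apply, measure_univ, smul_eq_mul]
  rw [one_add_one_eq_two]
  exact ENNReal.inv_mul_cancel two_ne_zero ENNReal.ofNat_ne_top

theorem integral_mix {X : Type*} [MeasurableSpace X] {ζ ν : Measure X} {f : X → ℝ}
    (hζ : Integrable f ζ) (hν : Integrable f ν) :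
    ∫ x, f x ∂(mix ζ ν) = 2⁻¹ * (∫ x, f x ∂ζ + ∫ x, f x ∂ν) := by
  rw [mix, integral_smul_measure, integral_add_measure hζ hν]
  simp

namespace MDP

variable {n m : ℕ} {S : Set (E n)} {A : Set (E m)} (M : MDP S A)

/-- The Lipschitz constant in the action of the `j`-th partial derivative in the state of the
action values. -/
noncomputable def lipPartialQ (π : Policy S A) (s : S) (j : Fin n) : ℝ≥0∞ :=
  lipConst fun a : A => gradOn (fun s' : S => M.Q π s' a) s j

theorem rpow_sum_lipPartialQ_le (π : Policy S A) (s : S) :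
    (∑ j, M.lipPartialQ π s j ^ 2) ^ (1 / 2 : ℝ) ≤ M.lipGradQ π :=
  le_iSup (fun s => (∑ j, M.lipPartialQ π s j ^ 2) ^ (1 / 2 : ℝ)) s

theorem lipPartialQ_le (π : Policy S A) (s : S) (j : Fin n) :
    M.lipPartialQ π s j ≤ M.lipGradQ π := by
  refine le_trans ?_ (M.rpow_sum_lipPartialQ_le π s)
  calc M.lipPartialQ π s j = (M.lipPartialQ π s j ^ 2) ^ (1 / 2 : ℝ) := by
        rw [← ENNReal.rpow_natCast, ← ENNReal.rpow_mul]
        norm_num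
    _ ≤ _ := by
        refine ENNReal.rpow_le_rpow ?_ (by norm_num)
        exact Finset.single_le_sum (f := fun j => M.lipPartialQ π s j ^ 2)
          (fun _ _ => zero_le) (Finset.mem_univ j)

variable {Pol : Set (Policy S A)} {M}

theorem Regular.enorm_Q_sub_le (hreg : M.Regular Pol) (hA : Convex ℝ A)
    (hAint : (interior A).Nonempty) {π : Policy S A} (hπ : π ∈ Pol) (s : S) (a a' : A) :
    ‖M.Q π s a - M.Q π s a'‖ₑ ≤ M.lipQ π * edist a a' := by
  have hle : lipConst (fun a : A => M.Q π s a) ≤ M.lipQ π :=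
    le_iSup (fun s => lipConst fun a : A => M.Q π s a) s
  refine ((hreg.diff_action π hπ s).enorm_sub_le_lipConst hA hAint
    (ne_top_of_le_ne_top (hreg.lipQ_ne_top π hπ) hle) a a').trans ?_
  exact mul_le_mul_left hle _

theorem Regular.lipPartialQ_ne_top (hreg : M.Regular Pol) {π : Policy S A} (hπ : π ∈ Pol)
    (s : S) (j : Fin n) : M.lipPartialQ π s j ≠ ∞ :=
  ne_top_of_le_ne_top (hreg.lipGradQ_ne_top π hπ) (M.lipPartialQ_le π s j)

theorem Regular.enorm_partialQ_sub_le (hreg : M.Regular Pol) (hA : Convex ℝ A)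
    (hAint : (interior A).Nonempty) {π : Policy S A} (hπ : π ∈ Pol) (s : S) (j : Fin n)
    (a a' : A) :
    ‖gradOn (fun s' : S => M.Q π s' a) s j - gradOn (fun s' : S => M.Q π s' a') s j‖ₑ ≤
      M.lipPartialQ π s j * edist a a' :=
  (hreg.diff_mixed π hπ s j).enorm_sub_le_lipConst hA hAint (hreg.lipPartialQ_ne_top hπ s j) a a'

/-- The gradient of $s\mapsto Q(s,a)-Q(s,a')$ has norm at most $\ell'\|a-a'\|$, by the componentwise
Lipschitz bounds. This mixed second difference supplies the dominating function for the limit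
$h\to0$ below. -/
theorem Regular.enorm_Q_sub_sub_le (hreg : M.Regular Pol) (hS : Convex ℝ S)
    (hSint : (interior S).Nonempty) (hA : Convex ℝ A) (hAint : (interior A).Nonempty)
    {π : Policy S A} (hπ : π ∈ Pol) (s s' : S) (a a' : A) :
    ‖(M.Q π s a - M.Q π s a') - (M.Q π s' a - M.Q π s' a')‖ₑ ≤
      M.lipGradQ π * edist a a' * edist s s' := by
  refine ((hreg.diff_state π hπ a).sub (hreg.diff_state π hπ a')).enorm_sub_le hS hSint
    (ENNReal.mul_ne_top (hreg.lipGradQ_ne_top π hπ) (edist_ne_top a a')) (fun z hz => ?_) s s'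
  rw [gradOn_sub (hreg.diff_state π hπ a) (hreg.diff_state π hπ a') hz, enorm_eq_rpow_sum]
  calc _ ≤ (∑ j, (edist a a' * M.lipPartialQ π z j) ^ 2) ^ (1 / 2 : ℝ) := by
        refine ENNReal.rpow_le_rpow (Finset.sum_le_sum fun j _ => ?_) (by norm_num)
        gcongr
        rw [mul_comm]
        exact hreg.enorm_partialQ_sub_le hA hAint hπ z j a a'
    _ ≤ _ := by
        rw [rpow_sum_mul_sq, mul_comm]
        exact mul_le_mul_left (M.rpow_sum_lipPartialQ_le π z) _

/-- The difference quotient in the state of the action value. -/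
noncomputable def quotQ (M : MDP S A) (π : Policy S A) (s : S) (j : Fin n) (h : ℝ) (a : A) : ℝ :=
  (M.Q π (coordLine s j h) a - M.Q π s a) / h

theorem measurable_quotQ (π : Policy S A) (s : S) (j : Fin n) (h : ℝ) :
    Measurable (M.quotQ π s j h) :=
  ((M.measurable_Q_action π _).sub (M.measurable_Q_action π _)).div_const _

theorem integrable_quotQ (π : Policy S A) (s : S) (j : Fin n) (h : ℝ) (ν : Measure A)
    [IsFiniteMeasure ν] : Integrable (M.quotQ π s j h) ν :=
  ((M.integrable_Q π _ ν).sub (M.integrable_Q π _ ν)).div_const _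

theorem Regular.tendsto_integral_quotQ (hreg : M.Regular Pol) (hS : Convex ℝ S)
    (hA : Convex ℝ A) (hAint : (interior A).Nonempty) {π : Policy S A} (hπ : π ∈ Pol) {s : S}
    (hs : (s : E n) ∈ interior S) (j : Fin n) {c : Measure (A × A)}
    (hc : ∫⁻ p, edist p.1 p.2 ∂c ≠ ∞) :
    Tendsto (fun h => ∫ p, (M.quotQ π s j h p.1 - M.quotQ π s j h p.2) ∂c) (𝓝[≠] (0 : ℝ))
      (𝓝 (∫ p : A × A, (gradOn (fun s' : S => M.Q π s' p.1) s j -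
        gradOn (fun s' : S => M.Q π s' p.2) s j) ∂c)) := by
  refine tendsto_integral_filter_of_dominated_convergence
    (fun p => (M.lipGradQ π * edist p.1 p.2).toReal) ?_ ?_ ?_ ?_
  · exact .of_forall fun h => (((measurable_quotQ π s j h).comp measurable_fst).sub
      ((measurable_quotQ π s j h).comp measurable_snd)).aestronglyMeasurable
  · filter_upwards [eventually_edist_coordLine hs j, self_mem_nhdsWithin] with h hh h0
    refine .of_forall fun p => ?_
    have h1 := hreg.enorm_Q_sub_sub_le hS ⟨_, hs⟩ hA hAint hπ (coordLine s j h) s p.1 p.2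
    have hfin : M.lipGradQ π * edist p.1 p.2 ≠ ∞ :=
      ENNReal.mul_ne_top (hreg.lipGradQ_ne_top π hπ) (edist_ne_top _ _)
    rw [hh] at h1
    have h2 := ENNReal.toReal_mono (ENNReal.mul_ne_top hfin enorm_ne_top) h1
    rw [ENNReal.toReal_mul, toReal_enorm, toReal_enorm] at h2
    have h3 : M.quotQ π s j h p.1 - M.quotQ π s j h p.2 =
        ((M.Q π (coordLine s j h) p.1 - M.Q π (coordLine s j h) p.2) -
          (M.Q π s p.1 - M.Q π s p.2)) / h := by
      unfold quotQ
      ring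
    rw [h3, norm_div, div_le_iff₀ (norm_pos_iff.2 h0)]
    exact h2
  · refine integrable_toReal_of_lintegral_ne_top (by fun_prop) ?_
    rw [lintegral_const_mul _ (by fun_prop)]
    exact ENNReal.mul_ne_top (hreg.lipGradQ_ne_top π hπ) hc
  · exact .of_forall fun p => ((hreg.diff_state π hπ p.1).tendsto_slope hs j).sub
      ((hreg.diff_state π hπ p.2).tendsto_slope hs j)

/-- The signed measure $\pi_2(s')+\pi_1(s)-\pi_2(s)-\pi_1(s')$ is twice a difference of two
mixtures, so duality applies to $Q(s',\cdot)$; this is the origin of the factor 2. The rest is the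
difference quotient of $Q$ integrated against $\pi_2(s)-\pi_1(s)$, written on a coupling that does
not depend on $h$. -/
theorem Regular.enorm_adv_increment_le (hreg : M.Regular Pol) (hA : Convex ℝ A)
    (hAint : (interior A).Nonempty) {π₁ : Policy S A} (h₁ : π₁ ∈ Pol) (π₂ : Policy S A)
    (s : S) (j : Fin n) (h : ℝ) {c : Measure (A × A)}
    (hc : IsCoupling (π₂.toKernel s) (π₁.toKernel s) c) :
    ‖(M.adv π₁ (coordLine s j h) π₂ - M.adv π₁ s π₂) / h‖ₑ ≤
      2 * M.lipQ π₁ * mixW π₁ π₂ s (coordLine s j h) / ‖h‖ₑ +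
        ‖∫ p, (M.quotQ π₁ s j h p.1 - M.quotQ π₁ s j h p.2) ∂c‖ₑ := by
  set s' := coordLine s j h with hs'
  have hi : ∀ (z : S) (ν : Measure A) [IsFiniteMeasure ν], Integrable (fun a => M.Q π₁ z a) ν :=
    fun z ν _ => M.integrable_Q π₁ z ν
  set X := ∫ a, M.Q π₁ s' a ∂(mix (π₂.toKernel s') (π₁.toKernel s)) -
    ∫ a, M.Q π₁ s' a ∂(mix (π₂.toKernel s) (π₁.toKernel s')) with hX
  have hXle : ‖X‖ₑ ≤ M.lipQ π₁ * mixW π₁ π₂ s s' :=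
    enorm_integral_sub_le_wass (M.measurable_Q_action π₁ s') (hi _ _) (hi _ _)
      (hreg.lipQ_ne_top π₁ h₁) (hreg.enorm_Q_sub_le hA hAint h₁ s')
  have hq : ∀ (ν : Measure A) [IsFiniteMeasure ν], ∫ a, M.quotQ π₁ s j h a ∂ν =
      (∫ a, M.Q π₁ s' a ∂ν - ∫ a, M.Q π₁ s a ∂ν) / h := by
    intro ν _
    unfold quotQ
    rw [integral_div, integral_sub (hi _ _) (hi _ _)]
  have heq : (M.adv π₁ s' π₂ - M.adv π₁ s π₂) / h =
      2 * X / h + ∫ p, (M.quotQ π₁ s j h p.1 - M.quotQ π₁ s j h p.2) ∂c := by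
    rw [← hc.integral_sub (measurable_quotQ π₁ s j h) (integrable_quotQ ..)
      (integrable_quotQ ..), hq, hq, adv_eq, adv_eq, hX, integral_mix (hi _ _) (hi _ _),
      integral_mix (hi _ _) (hi _ _)]
    ring
  rw [heq]
  refine (enorm_add_le _ _).trans (add_le_add_left ?_ _)
  rcases eq_or_ne h 0 with rfl | h0
  · simp
  · have h2 : ‖(2 : ℝ)‖ₑ = 2 := by
      rw [← ofReal_norm]
      norm_num
    rw [div_eq_mul_inv, enorm_mul, enorm_mul, enorm_inv h0, ← div_eq_mul_inv, h2, mul_assoc 2]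
    gcongr

theorem Regular.enorm_gradOn_adv_le (hreg : M.Regular Pol) (hS : Convex ℝ S) (hA : Convex ℝ A)
    (hAint : (interior A).Nonempty) {π₁ π₂ : Policy S A} (h₁ : π₁ ∈ Pol) (h₂ : π₂ ∈ Pol) {s : S}
    (hs : (s : E n) ∈ interior S) (j : Fin n) (hpart : partialMixW π₁ π₂ s j ≠ ∞)
    (hW : wass (π₂.toKernel s) (π₁.toKernel s) ≠ ∞) :
    ‖gradOn (fun s => M.adv π₁ s π₂) s j‖ₑ ≤
      2 * M.lipQ π₁ * partialMixW π₁ π₂ s j +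
        M.lipPartialQ π₁ s j * wass (π₂.toKernel s) (π₁.toKernel s) := by
  have hℓ : 2 * M.lipQ π₁ ≠ ∞ := ENNReal.mul_ne_top ENNReal.ofNat_ne_top (hreg.lipQ_ne_top π₁ h₁)
  have hℓ' := hreg.lipPartialQ_ne_top h₁ s j
  -- Here $b$ strictly exceeds the limsup, so it bounds the quotients for small $h$, and $r$
  -- strictly exceeds the Wasserstein distance, so some coupling costs less. After $h\to0$, both
  -- decrease to their infima.
  have key : ∀ b, partialMixW π₁ π₂ s j < b → ∀ r, wass (π₂.toKernel s) (π₁.toKernel s) < r →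
      ‖gradOn (fun s => M.adv π₁ s π₂) s j‖ₑ ≤ 2 * M.lipQ π₁ * b + M.lipPartialQ π₁ s j * r := by
    intro b hb r hr
    obtain ⟨c, hr⟩ := iInf_lt_iff.1 hr
    obtain ⟨hc, hr⟩ := iInf_lt_iff.1 hr
    have hmix := (tendsto_coordLine hs j).eventually (eventually_lt_of_limsup_lt hb)
    have hlim := ((hreg.diff_adv π₁ h₁ π₂ h₂).tendsto_slope hs j).enorm
    have hlim' := (hreg.tendsto_integral_quotQ hS hA hAint h₁ hs j
      (ne_top_of_lt hr)).enorm.const_add (2 * M.lipQ π₁ * b)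
    refine (le_of_tendsto_of_tendsto hlim hlim' ?_).trans (add_le_add_right ?_ _)
    · filter_upwards [hmix, eventually_edist_coordLine hs j] with h hh he
      refine (hreg.enorm_adv_increment_le hA hAint h₁ π₂ s j h hc).trans (add_le_add_left ?_ _)
      rw [he] at hh
      rw [mul_div_assoc]
      exact mul_le_mul_right hh.le _
    · refine (enorm_integral_le_lintegral_enorm _).trans ?_
      have hm : Measurable fun p : A × A => edist p.1 p.2 := by fun_prop
      have hle : ∫⁻ p : A × A, ‖gradOn (fun s' : S => M.Q π₁ s' p.1) s j -
            gradOn (fun s' : S => M.Q π₁ s' p.2) s j‖ₑ ∂c ≤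
          ∫⁻ p, M.lipPartialQ π₁ s j * edist p.1 p.2 ∂c :=
        lintegral_mono fun p => hreg.enorm_partialQ_sub_le hA hAint h₁ s j p.1 p.2
      refine hle.trans ?_
      rw [lintegral_const_mul _ hm]
      exact mul_le_mul_right hr.le _
  have hne₁ : (𝓝[>] partialMixW π₁ π₂ s j).NeBot :=
    nhdsGT_neBot_of_exists_gt ⟨∞, hpart.lt_top⟩
  have hne₂ : (𝓝[>] wass (π₂.toKernel s) (π₁.toKernel s)).NeBot :=
    nhdsGT_neBot_of_exists_gt ⟨∞, hW.lt_top⟩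
  have hlim : Tendsto (fun p : ℝ≥0∞ × ℝ≥0∞ => 2 * M.lipQ π₁ * p.1 + M.lipPartialQ π₁ s j * p.2)
      (𝓝[>] partialMixW π₁ π₂ s j ×ˢ 𝓝[>] wass (π₂.toKernel s) (π₁.toKernel s))
      (𝓝 (2 * M.lipQ π₁ * partialMixW π₁ π₂ s j +
        M.lipPartialQ π₁ s j * wass (π₂.toKernel s) (π₁.toKernel s))) :=
    (ENNReal.Tendsto.const_mul (tendsto_fst.mono_right nhdsWithin_le_nhds) (Or.inr hℓ)).add
      (ENNReal.Tendsto.const_mul (tendsto_snd.mono_right nhdsWithin_le_nhds) (Or.inr hℓ'))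
  refine ge_of_tendsto hlim ?_
  filter_upwards [prod_mem_prod self_mem_nhdsWithin self_mem_nhdsWithin] with p hp
  exact key _ hp.1 _ hp.2

theorem Regular.enorm_adv_sub_le (hreg : M.Regular Pol) (hS : Convex ℝ S)
    (hSint : (interior S).Nonempty) (hA : Convex ℝ A) (hAint : (interior A).Nonempty)
    {π₁ π₂ : Policy S A} (h₁ : π₁ ∈ Pol) (h₂ : π₂ ∈ Pol) (hG : ⨆ s, LG2 π₁ π₂ s ≠ ∞)
    (hW : policyW π₁ π₂ ≠ ∞) (s s' : S) :
    ‖M.adv π₁ s π₂ - M.adv π₁ s' π₂‖ₑ ≤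
      (2 * M.lipQ π₁ * (⨆ s, LG2 π₁ π₂ s) ^ (1 / 2 : ℝ) + M.lipGradQ π₁ * policyW π₁ π₂) *
        edist s s' := by
  have hWs : ∀ s, wass (π₂.toKernel s) (π₁.toKernel s) ≤ policyW π₁ π₂ := by
    intro s
    rw [wass_comm]
    exact le_iSup (fun s => wass (π₁.toKernel s) (π₂.toKernel s)) s
  have hGs : ∀ s, LG2 π₁ π₂ s ≤ ⨆ s, LG2 π₁ π₂ s := le_iSup _
  have hpart : ∀ s j, partialMixW π₁ π₂ s j ≠ ∞ := by
    intro s j htop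
    refine ne_top_of_le_ne_top hG (hGs s) ?_
    exact ENNReal.sum_eq_top.2 ⟨j, Finset.mem_univ j, by simp [htop]⟩
  refine (hreg.diff_adv π₁ h₁ π₂ h₂).enorm_sub_le hS hSint ?_ (fun z hz => ?_) s s'
  · refine ENNReal.add_ne_top.2 ⟨ENNReal.mul_ne_top (ENNReal.mul_ne_top ENNReal.ofNat_ne_top
      (hreg.lipQ_ne_top π₁ h₁)) (ENNReal.rpow_ne_top_of_nonneg (by norm_num) hG),
      ENNReal.mul_ne_top (hreg.lipGradQ_ne_top π₁ h₁) hW⟩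
  · rw [enorm_eq_rpow_sum]
    calc _ ≤ (∑ j, (2 * M.lipQ π₁ * partialMixW π₁ π₂ z j +
            policyW π₁ π₂ * M.lipPartialQ π₁ z j) ^ 2) ^ (1 / 2 : ℝ) := by
          refine ENNReal.rpow_le_rpow (Finset.sum_le_sum fun j _ => ?_) (by norm_num)
          refine pow_le_pow_left₀ zero_le ?_ 2
          refine (hreg.enorm_gradOn_adv_le hS hA hAint h₁ h₂ hz j (hpart z j)
            (ne_top_of_le_ne_top hW (hWs z))).trans ?_
          rw [mul_comm (policyW π₁ π₂)]
          gcongr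
          exact hWs z
      _ ≤ 2 * M.lipQ π₁ * (∑ j, partialMixW π₁ π₂ z j ^ 2) ^ (1 / 2 : ℝ) +
          policyW π₁ π₂ * (∑ j, M.lipPartialQ π₁ z j ^ 2) ^ (1 / 2 : ℝ) := by
          rw [← rpow_sum_mul_sq, ← rpow_sum_mul_sq]
          -- Minkowski's inequality over the coordinates keeps Euclidean norms on both pieces, so no
          -- dimensional constant appears.
          exact rpow_sum_add_sq_le _ _ _
      _ ≤ _ := by
          rw [mul_comm (policyW π₁ π₂)]
          gcongr
          · exact hGs z
          · exact M.rpow_sum_lipPartialQ_le π₁ z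

end MDP

end TDPO

namespace TDPO

/-! ### The surrogate bound -/

theorem rpow_half_sq (x : ℝ≥0∞) : (x ^ (1 / 2 : ℝ)) ^ 2 = x := by
  rw [← ENNReal.rpow_natCast, ← ENNReal.rpow_mul]
  norm_num

theorem mul_le_young {x y : ℝ≥0∞} (hx : x ≠ ∞) (hy : y ≠ ∞) {α : ℝ} (hα : α ≠ 0) :
    x * y ≤ ENNReal.ofReal (α ^ 2 / 2) * x ^ 2 + ENNReal.ofReal (1 / (2 * α ^ 2)) * y ^ 2 := by
  lift x to ℝ≥0 using hx
  lift y to ℝ≥0 using hy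
  rw [← ENNReal.ofReal_coe_nnreal (p := x), ← ENNReal.ofReal_coe_nnreal (p := y),
    ← ENNReal.ofReal_mul (by positivity), ← ENNReal.ofReal_pow (by positivity),
    ← ENNReal.ofReal_pow (by positivity), ← ENNReal.ofReal_mul (by positivity),
    ← ENNReal.ofReal_mul (by positivity), ← ENNReal.ofReal_add (by positivity) (by positivity)]
  refine ENNReal.ofReal_le_ofReal ?_
  have h : α ^ 2 / 2 * (x : ℝ) ^ 2 + 1 / (2 * α ^ 2) * (y : ℝ) ^ 2 - x * y =
      (α * x - y / α) ^ 2 / 2 := by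
    field_simp
    ring
  nlinarith [sq_nonneg (α * (x : ℝ) - y / α)]

theorem coe_sub_le_of_enorm_sub_le {x y : ℝ} {p : ℝ≥0∞} (h : ‖x - y‖ₑ ≤ p) :
    (x : EReal) - (p : EReal) ≤ (y : EReal) := by
  rcases eq_or_ne p ∞ with rfl | hp
  · simp
  · lift p to ℝ≥0 using hp
    rw [EReal.coe_nnreal_eq_coe_real, ← EReal.coe_sub, EReal.coe_le_coe_iff]
    rw [enorm_eq_nnnorm, ENNReal.coe_le_coe, ← NNReal.coe_le_coe, coe_nnnorm,
      Real.norm_eq_abs] at h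
    linarith [le_abs_self (x - y)]

section Policies

variable {n m : ℕ} {S : Set (E n)} {A : Set (E m)}

theorem policyW_sq (π₁ π₂ : Policy S A) :
    policyW π₁ π₂ ^ 2 = ⨆ s : S, wass (π₂.toKernel s) (π₁.toKernel s) ^ 2 := by
  unfold policyW
  rw [ENNReal.iSup_pow_of_ne_zero two_ne_zero]
  simp only [wass_comm]

theorem mixW_self (π : Policy S A) (s s' : S) : mixW π π s s' = 0 := by
  unfold mixW mix
  rw [add_comm, wass_self]

theorem LG2_self (π : Policy S A) (s : S) : LG2 π π s = 0 := by
  refine Finset.sum_eq_zero fun j _ => ?_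
  have h : partialMixW π π s j = 0 := by
    unfold partialMixW
    simp only [mixW_self, ENNReal.zero_div]
    exact limsup_const_bot
  rw [h, zero_pow two_ne_zero]

end Policies

namespace MDP

variable {n m : ℕ} {S : Set (E n)} {A : Set (E m)} {M : MDP S A} {Pol : Set (Policy S A)}

theorem surrogate_self (κ : ℝ≥0∞) (α : ℝ) (π : Policy S A) :
    M.surrogate κ α π π = (M.payoff π : EReal) := by
  simp [surrogate, adv_self, LG2_self]

theorem Regular.adv_eq_zero_of_lipQ_eq_zero (hreg : M.Regular Pol) (hA : Convex ℝ A)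
    (hAint : (interior A).Nonempty) {π₁ : Policy S A} (h₁ : π₁ ∈ Pol) (h0 : M.lipQ π₁ = 0)
    (π₂ : Policy S A) (s : S) : M.adv π₁ s π₂ = 0 := by
  have h := enorm_integral_sub_le_wass (ζ := π₂.toKernel s) (ν := π₁.toKernel s)
    (M.measurable_Q_action π₁ s) (M.integrable_Q π₁ s _) (M.integrable_Q π₁ s _)
    (hreg.lipQ_ne_top π₁ h₁) (hreg.enorm_Q_sub_le hA hAint h₁ s)
  rw [h0, zero_mul, nonpos_iff_eq_zero, enorm_eq_zero] at h
  rw [adv_eq, h]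

/-- The error of replacing the visitation frequency of `π₂` by that of `π₁`. -/
theorem enorm_surrogate_error_le (M : MDP S A) (π₁ π₂ : Policy S A) :
    ‖(M.payoff π₁ + (1 - M.γ)⁻¹ * ∫ s, M.adv π₁ s π₂ ∂(M.visit M.μ π₁)) - M.payoff π₂‖ₑ ≤
      ∑' t, ENNReal.ofReal M.γ ^ t *
        ‖∫ s, M.adv π₁ s π₂ ∂(M.steps M.μ π₁ t) - ∫ s, M.adv π₁ s π₂ ∂(M.steps M.μ π₂ t)‖ₑ := by
  have h : (M.payoff π₁ + (1 - M.γ)⁻¹ * ∫ s, M.adv π₁ s π₂ ∂(M.visit M.μ π₁)) - M.payoff π₂ =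
      ∑' t, M.γ ^ t *
        (∫ s, M.adv π₁ s π₂ ∂(M.steps M.μ π₁ t) - ∫ s, M.adv π₁ s π₂ ∂(M.steps M.μ π₂ t)) := by
    simp only [mul_sub]
    rw [(M.summable_adv π₁ π₂ π₁).tsum_sub (M.summable_adv π₁ π₂ π₂), ← integral_visit,
      ← payoff_sub_payoff]
    ring
  rw [h]
  refine (enorm_tsum_le_tsum_enorm).trans (le_of_eq (tsum_congr fun t => ?_))
  rw [enorm_mul, enorm_pow, Real.enorm_of_nonneg M.γ_nonneg]

theorem Regular.surrogate_le_payoff [StandardBorelSpace S] [Nonempty S] (hreg : M.Regular Pol)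
    (hS : Convex ℝ S) (hSint : (interior S).Nonempty) (hA : Convex ℝ A)
    (hAint : (interior A).Nonempty) {Lπ Lμ : ℝ≥0} (hLπ : M.LipschitzPolicy Pol Lπ)
    (hLμ : M.LipschitzState Pol Lμ) {κ : ℝ≥0∞} (hκ : M.IsAmplification Pol Lπ Lμ κ) {α : ℝ}
    (hα : α ≠ 0) {π₁ π₂ : Policy S A} (h₁ : π₁ ∈ Pol) (h₂ : π₂ ∈ Pol) :
    M.surrogate κ α π₁ π₂ ≤ (M.payoff π₂ : EReal) := by
  refine coe_sub_le_of_enorm_sub_le ((M.enorm_surrogate_error_le π₁ π₂).trans ?_)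
  have hsum := M.tsum_discount_wass_le hLπ hLμ hκ h₁ h₂
  set r := ENNReal.ofReal (M.γ / (1 - M.γ)) with hr
  set G := ⨆ s : S, LG2 π₁ π₂ s with hG
  set Δ := ⨆ s : S, wass (π₂.toKernel s) (π₁.toKernel s) ^ 2 with hΔ
  -- With $0\cdot\infty=0$, vanishing coefficients can hide an infinite $G$ or $\Delta$, so
  -- degenerate cases come first. Here at each time the discount weight is zero or the two state
  -- laws coincide.
  rcases eq_or_ne (r * κ) 0 with hrκ | hrκ
  · rw [hrκ, zero_mul, nonpos_iff_eq_zero, ENNReal.tsum_eq_zero] at hsum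
    refine le_of_eq_of_le (ENNReal.tsum_eq_zero.2 fun t => ?_) zero_le
    rcases mul_eq_zero.1 (hsum t) with h | h
    · rw [h, zero_mul]
    · rw [eq_of_wass_eq_zero h, sub_self, enorm_zero, mul_zero]
  -- Now $C_1=0$ and $G$ may be infinite, but $Q$ is constant in the action and the advantage
  -- vanishes.
  rcases eq_or_ne (M.lipQ π₁) 0 with hℓ | hℓ
  · simp [hreg.adv_eq_zero_of_lipQ_eq_zero hA hAint h₁ hℓ π₂]
  rcases eq_or_ne (M.C1 κ α π₁ * G + M.C2 κ α π₁ * Δ) ∞ with htop | htop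
  · rw [htop]
    exact le_top
  have hα2 : 0 < α ^ 2 := by positivity
  have hC1' : M.C1' κ π₁ ≠ 0 := by
    unfold C1'
    rw [mul_assoc]
    exact mul_ne_zero (mul_ne_zero two_ne_zero hℓ) hrκ
  have hC1 : M.C1 κ α π₁ ≠ 0 :=
    mul_ne_zero hC1' (ENNReal.ofReal_pos.2 (by positivity)).ne'
  have hC2 : M.C2 κ α π₁ ≠ 0 := by
    unfold C2
    intro h
    exact mul_ne_zero hC1' (ENNReal.ofReal_pos.2 (by positivity)).ne' (add_eq_zero.1 h).2
  -- Both coefficients are now non-zero and the total penalty is finite, which forces $G$ and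
  -- $\Delta$ to be finite.
  have hGtop : G ≠ ∞ := by
    intro h
    rw [h, ENNReal.mul_top hC1, top_add] at htop
    exact htop rfl
  have hΔtop : Δ ≠ ∞ := by
    intro h
    rw [h, ENNReal.mul_top hC2, add_top] at htop
    exact htop rfl
  have hδΔ : policyW π₁ π₂ ^ 2 = Δ := policyW_sq π₁ π₂
  have hδ : policyW π₁ π₂ ≠ ∞ := by
    intro h
    rw [h, ENNReal.top_pow two_ne_zero] at hδΔ
    exact hΔtop hδΔ.symm
  have hGhalf : G ^ (1 / 2 : ℝ) ≠ ∞ := ENNReal.rpow_ne_top_of_nonneg (by norm_num) hGtop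
  set K := 2 * M.lipQ π₁ * G ^ (1 / 2 : ℝ) + M.lipGradQ π₁ * policyW π₁ π₂ with hK
  have hKtop : K ≠ ∞ :=
    ENNReal.add_ne_top.2 ⟨ENNReal.mul_ne_top (ENNReal.mul_ne_top ENNReal.ofNat_ne_top
      (hreg.lipQ_ne_top π₁ h₁)) hGhalf, ENNReal.mul_ne_top (hreg.lipGradQ_ne_top π₁ h₁) hδ⟩
  have hterm : ∀ t, ‖∫ s, M.adv π₁ s π₂ ∂(M.steps M.μ π₁ t) -
      ∫ s, M.adv π₁ s π₂ ∂(M.steps M.μ π₂ t)‖ₑ ≤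
        K * wass (M.steps M.μ π₁ t) (M.steps M.μ π₂ t) := fun t =>
    enorm_integral_sub_le_wass (M.measurable_adv π₁ π₂) (M.integrable_adv π₁ π₂ _)
      (M.integrable_adv π₁ π₂ _) hKtop
      (hreg.enorm_adv_sub_le hS hSint hA hAint h₁ h₂ hGtop hδ)
  calc _ ≤ ∑' t, K * (ENNReal.ofReal M.γ ^ t *
          wass (M.steps M.μ π₁ t) (M.steps M.μ π₂ t)) := by
        refine ENNReal.tsum_le_tsum fun t => (mul_le_mul_right (hterm t) _).trans (le_of_eq ?_)
        ring
    _ ≤ K * (r * κ * policyW π₁ π₂) := by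
        rw [ENNReal.tsum_mul_left]
        exact mul_le_mul_right hsum _
    _ = 2 * M.lipQ π₁ * r * κ * (G ^ (1 / 2 : ℝ) * policyW π₁ π₂) +
          M.lipGradQ π₁ * r * κ * policyW π₁ π₂ ^ 2 := by
        rw [hK]
        ring
    _ ≤ 2 * M.lipQ π₁ * r * κ * (ENNReal.ofReal (α ^ 2 / 2) * G +
          ENNReal.ofReal (1 / (2 * α ^ 2)) * Δ) + M.lipGradQ π₁ * r * κ * Δ := by
        have hy := mul_le_young hGhalf hδ hα
        rw [rpow_half_sq, hδΔ] at hy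
        rw [hδΔ]
        gcongr
    _ = M.C1 κ α π₁ * G + M.C2 κ α π₁ * Δ := by
        unfold C1 C2 C1' C2'
        ring

end MDP

end TDPO

theorem mainTheorem2 {n m : ℕ} (S : Set (TDPO.E n)) (A : Set (TDPO.E m))
    (hS : MeasurableSet S) (hSconv : Convex ℝ S) (hSint : (interior S).Nonempty)
    (hA : MeasurableSet A) (hAconv : Convex ℝ A) (hAint : (interior A).Nonempty)
    (M : TDPO.MDP S A) (Pol : Set (TDPO.Policy S A)) (hreg : M.Regular Pol)
    (Lπ Lμ : ℝ≥0) (hLπ : M.LipschitzPolicy Pol Lπ) (hLμ : M.LipschitzState Pol Lμ)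
    (κ : ℝ≥0∞) (hκ : M.IsAmplification Pol Lπ Lμ κ) :
    (∀ α : ℝ, α ≠ 0 → ∀ π₁ ∈ Pol, ∀ π₂ ∈ Pol,
      M.surrogate κ α π₁ π₂ ≤ (M.payoff π₂ : EReal)) ∧
    (∀ α : ℝ, α ≠ 0 → ∀ π₁ ∈ Pol, M.surrogate κ α π₁ π₁ = (M.payoff π₁ : EReal)) ∧
    (∀ α : ℕ → ℝ, (∀ k, α k ≠ 0) → ∀ π : ℕ → TDPO.Policy S A, (∀ k, π k ∈ Pol) →
      (∀ k, IsMaxOn (M.surrogate κ (α k) (π k)) Pol (π (k + 1))) →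
      Monotone fun k => M.payoff (π k)) := by
  have := hS.standardBorel
  have : Nonempty S := (hSint.mono interior_subset).to_subtype
  have hle : ∀ α : ℝ, α ≠ 0 → ∀ π₁ ∈ Pol, ∀ π₂ ∈ Pol,
      M.surrogate κ α π₁ π₂ ≤ (M.payoff π₂ : EReal) := fun α hα π₁ h₁ π₂ h₂ =>
    hreg.surrogate_le_payoff hSconv hSint hAconv hAint hLπ hLμ hκ hα h₁ h₂
  refine ⟨hle, fun α _ π₁ _ => TDPO.MDP.surrogate_self κ α π₁, fun α hα π hπ hmax => ?_⟩
  refine monotone_nat_of_le_succ fun k => ?_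
  rw [← EReal.coe_le_coe_iff, ← TDPO.MDP.surrogate_self κ (α k) (π k)]
  -- Maximality is tested against $\pi_k$ itself, where the surrogate equals $\eta_{\pi_k}$.
  exact (hmax k (hπ k)).trans (hle (α k) (hα k) (π k) (hπ k) (π (k + 1)) (hπ (k + 1)))
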